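/- Let $\Omega\subset\mathbb R^2$ be a bounded polygonal domain (open, connected, equal to the interior of its closure; this includes every polygonal domain with Lipschitz boundary), let $\alpha\in[0,1]$ and let $u(x_1,x_2)=x_1^2+x_2^2$. For a conforming triangulation $\mathcal T_h$ of $\overline\Omega$ let $h$ be the maximal diameter of its elements and let $X_h$ be the space of continuous functions on $\overline\Omega$ that are affine on every element. A (straight) band in $\mathcal T_h$ is a union of elements $\mathcal B=\bigcup_{i=0}^N K_i\cup\bigcup_{i=1}^N\tilde K_i$, $N\ge 1$, of the following form: $P_0,\dots,P_{N+1}$ are consecutive points on a line, $Q_0,\dots,Q_N$ lie strictly on one side of that line, $K_i$ is the triangle $P_iQ_iP_{i+1}$ with maximum angle $\alpha_i$ attained at $Q_i$, and $\tilde K_i$ is the triangle $Q_{i-1}P_iQ_i$ with maximum angle $\tilde\alpha_i$ attained at $P_i$. Its length is $L=\sum_{i=0}^N|P_{i+1}-P_i|$. For constants $C_K,C_\alpha$ consider the assumptions $$|\tilde K_i|\le C_K|K_i|,\qquad |\tilde K_i|\le C_K|K_{i-1}|,\qquad \sin(\pi-\alpha_{i-1})\le C_\alpha\sin(\pi-\tilde\alpha_i)\qquad(i=1,\dots,N).\tag{1}$$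 There is a function $C_L:(0,\infty)\to(0,\infty)$, depending only on $\Omega$ and $\alpha$, with $C_L(s)\to0$ as $s\to0^+$, such that for every $C_u>0$ the following hold. (a) For all $C_K,C_\alpha$ there is a constant $C>0$, depending only on $\Omega,\alpha,C_u,C_K,C_\alpha$, such that for every conforming triangulation $\mathcal T_h$ of $\overline\Omega$ for which some $U\in X_h$ satisfies the error estimate $$|u-U|_{H^1(\Omega)}\le C_u h^\alpha,\tag{2}$$ every band in $\mathcal T_h$ that satisfies (1) and $L\ge C_L(C_u)\,h^{2\alpha/5}$ also satisfies $$\min_{1\le i\le N}\frac1{\sin(\pi-\tilde\alpha_i)}\;\min_{1\le i\le N}|\tilde K_i|^{1/2}\;L\,N^{-1/2}\le C h^\alpha .$$ (b) There is a constant $C>0$, depending only on $\Omega,\alpha,C_u$, such that for every conforming triangulation $\mathcal T_h$ of $\overline\Omega$ for which some $U\in X_h$ satisfies (2), every band in $\mathcal T_h$ with $L\ge C_L(C_u)\,h^{2\alpha/5}$ that consists of congruent isosceles triangles with base $h$ and height $\bar h$ (that is, $P_i=P_0+ih\,g$ and $Q_i=P_i+\tfrac h2g+\bar h\,n$ with orthonormal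 $g,n$) satisfies $\bar h\ge C\,h^{4-2\alpha}L$. -/

import Mathlib

open MeasureTheory Filter Topology

noncomputable section

namespace FEM

/-- The Euclidean plane `ℝ²`. -/
abbrev Plane := EuclideanSpace ℝ (Fin 2)

/-- A finite conforming triangulation of `closure Ω`. An element is recorded by the set of its three
vertices; the closed triangle itself is the convex hull of that set. Two elements meet exactly in
the convex hull of their common vertices, i.e. they are disjoint, or share one vertex, or share one
full edge, or coincide. -/
structure Triangulation (Ω : Set Plane) where
  elements : Set (Set Plane)
  finite : elements.Finite
  nondegenerate : ∀ s ∈ elements, ∃ a b c : Plane, AffineIndependent ℝ ![a, b, c] ∧ s = {a, b, c}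
  conforming : ∀ s ∈ elements, ∀ t ∈ elements,
    convexHull ℝ s ∩ convexHull ℝ t = convexHull ℝ (s ∩ t)
  cover : ⋃ s ∈ elements, convexHull ℝ s = closure Ω

/-- The mesh size `h`: the largest diameter of an element. -/
def Triangulation.meshSize {Ω : Set Plane} (T : Triangulation Ω) : ℝ :=
  sSup ((fun s : Set Plane => Metric.diam (convexHull ℝ s)) '' T.elements)

/-- The finite element space `X_h`: functions that are continuous on `closure Ω` and affine on every
element (values outside `closure Ω` play no role). -/
def Triangulation.feSpace {Ω : Set Plane} (T : Triangulation Ω) : Set (Plane → ℝ) :=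
  {U | ContinuousOn U (closure Ω) ∧
    ∀ s ∈ T.elements, ∃ A : Plane →ᵃ[ℝ] ℝ, ∀ x ∈ convexHull ℝ s, U x = A x}

/-- The seminorm `|f|_{H¹(Ω)} = (∫_Ω |∇f|²)^{1/2}`. It is used only for `f = u - U` with `u` smooth
and `U ∈ X_h`; such an `f` is Lipschitz on each element and smooth off the (null) union of the
element edges, so its classical gradient there is its weak gradient. -/
def h1Seminorm (Ω : Set Plane) (f : Plane → ℝ) : ℝ :=
  √(∫ x in Ω, ‖gradient f x‖ ^ 2)

/-- The quadratic function `u(x₁, x₂) = x₁² + x₂²`. -/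
def quadratic (x : Plane) : ℝ := x 0 ^ 2 + x 1 ^ 2

/-- The area of the triangle with the given vertex set. -/
def area (s : Set Plane) : ℝ := (volume (convexHull ℝ s)).toReal

/-- The maximum angle of the triangle `A B C`. -/
def maxAngle (A B C : Plane) : ℝ :=
  max (EuclideanGeometry.angle B A C)
    (max (EuclideanGeometry.angle A B C) (EuclideanGeometry.angle A C B))

/-- A straight band of elements of `T`. The points `P 0, …, P (N+1)` follow one another on a line,
the points `Q 0, …, Q N` lie strictly on one side of that line, and the elements of the band are
`K i = P i, Q i, P (i+1)` for `i = 0, …, N`, with maximum angle at `Q i`, and, alternating with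
these, `K̃ i = Q (i-1), P i, Q i` for `i = 1, …, N`, with maximum angle at `P i`.
Thus `K (i-1), K̃ i` share the edge `Q (i-1), P i` and `K̃ i, K i` share the edge `P i, Q i`. In the
code the index `i : Fin N` of `K̃` is shifted by one. -/
structure Band {Ω : Set Plane} (T : Triangulation Ω) (N : ℕ) where
  P : Fin (N + 2) → Plane
  Q : Fin (N + 1) → Plane
  straight : ∃ g : Plane, ‖g‖ = 1 ∧ ∃ t : Fin (N + 2) → ℝ, StrictMono t ∧
    ∀ i, P i = P 0 + t i • g
  oneSide : ∀ i j, (affineSpan ℝ (Set.range P)).SSameSide (Q i) (Q j)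
  mem_K : ∀ i : Fin (N + 1), {P i.castSucc, Q i, P i.succ} ∈ T.elements
  mem_Ktilde : ∀ i : Fin N, {Q i.castSucc, P i.succ.castSucc, Q i.succ} ∈ T.elements
  maxAngle_K : ∀ i : Fin (N + 1),
    maxAngle (P i.castSucc) (Q i) (P i.succ) =
      EuclideanGeometry.angle (P i.castSucc) (Q i) (P i.succ)
  maxAngle_Ktilde : ∀ i : Fin N,
    maxAngle (Q i.castSucc) (P i.succ.castSucc) (Q i.succ) =
      EuclideanGeometry.angle (Q i.castSucc) (P i.succ.castSucc) (Q i.succ)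

namespace Band

variable {Ω : Set Plane} {T : Triangulation Ω} {N : ℕ} (B : Band T N)

/-- The vertices of `K i`, `i = 0, …, N`. -/
def K (i : Fin (N + 1)) : Set Plane := {B.P i.castSucc, B.Q i, B.P i.succ}

/-- The vertices of `K̃ (i+1)`, `i = 0, …, N-1`: the element between `K i` and `K (i+1)`. -/
def Ktilde (i : Fin N) : Set Plane := {B.Q i.castSucc, B.P i.succ.castSucc, B.Q i.succ}

/-- The maximum angle of `K i`. -/
def alpha (i : Fin (N + 1)) : ℝ := maxAngle (B.P i.castSucc) (B.Q i) (B.P i.succ)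

/-- The maximum angle of `K̃ (i+1)`. -/
def alphaTilde (i : Fin N) : ℝ :=
  maxAngle (B.Q i.castSucc) (B.P i.succ.castSucc) (B.Q i.succ)

/-- The length of `Γ`, the union of the longest edges of the `K i`. -/
def length : ℝ := ∑ i : Fin (N + 1), dist (B.P i.castSucc) (B.P i.succ)

/-- The geometric comparability assumptions on a band. -/
def Comparable (C_K C_α : ℝ) : Prop :=
  ∀ i : Fin N,
    area (B.Ktilde i) ≤ C_K * area (B.K i.succ) ∧
    area (B.Ktilde i) ≤ C_K * area (B.K i.castSucc) ∧
    Real.sin (Real.pi - B.alpha i.castSucc) ≤ C_α * Real.sin (Real.pi - B.alphaTilde i)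

/-- The band consists of congruent isosceles triangles with base `b` and height `hbar`. -/
def IsRegularIsosceles (b hbar : ℝ) : Prop :=
  0 < hbar ∧ ∃ g n : Plane, ‖g‖ = 1 ∧ ‖n‖ = 1 ∧ inner ℝ g n = 0 ∧
    (∀ i, B.P i = B.P 0 + ((i : ℕ) * b : ℝ) • g) ∧
    ∀ i : Fin (N + 1), B.Q i = B.P i.castSucc + (b / 2) • g + hbar • n

end Band

end FEM

end

/-! Write `f = u - U`. The proof plays two bounds on one quantity against each other:
`slopeVariation`, the total variation of the tangential derivative of `U` along the base line of the
band.

Lower bound. Along any unit direction `u` has second differences `2δ²`. If the slopes of `U` varied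
by at most `δ/2`, then `f` would have second differences of size at least `δ²` on the base line
(`Band.sq_le_abs_second_difference`). A line is a null set, but this still forces energy. Each
second difference is a signed sum of four increments of `f` along transversal segments whose far
ends cancel in pairs, and integrating over the starting point gives `δ⁵ ≤ const * |f|²` in the `H¹`
seminorm (`IsElementGradient.pow_five_le`). The error estimate contradicts this once `δ` exceeds a
multiple of `C_u^(2/5) * h^(2α/5)`, hence the threshold on the length. Transversal room inside a
possibly nonconvex domain comes from one fixed triangulation `T₀`: a fixed fraction of the base line
lies in a single triangle of `T₀`. Thus the variation exceeds a fixed multiple of `L`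
(`Band.lt_slopeVariation`).

Upper bound. The gradients on two neighbouring elements differ by a vector normal to the common
edge. The two inner edges at `P i` make an angle with the base line whose sine is at most twice that
of the maximum angle of `K̃ i`, so only this fraction of the jump is tangential
(`Band.abs_slope_sub_le`). The squared jumps, weighted by area, sum to at most a multiple of `|f|² +
h²` (`Band.sum_area_mul_jump_sq_le`), and Cauchy-Schwarz over the `N` jumps finishes
(`Band.iInf_mul_slopeVariation_le`). Part (b) inserts the explicit sine, area and length. -/

namespace FEM

/-! ### The cross product on the plane and areas -/

/-- The cross product of two plane vectors. -/
def cross (v w : Plane) : ℝ := v 0 * w 1 - v 1 * w 0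

/-- The linear map sending the standard basis to `v, w`. -/
noncomputable def frameMap (v w : Plane) : Plane →ₗ[ℝ] Plane where
  toFun x := x 0 • v + x 1 • w
  map_add' x y := by simp only [PiLp.add_apply, add_smul]; abel
  map_smul' c x := by simp [mul_smul]

theorem frameMap_apply (v w x : Plane) : frameMap v w x = x 0 • v + x 1 • w := rfl

theorem det_frameMap (v w : Plane) : LinearMap.det (frameMap v w) = cross v w := by
  rw [← LinearMap.det_toMatrix (EuclideanSpace.basisFun (Fin 2) ℝ).toBasis, Matrix.det_fin_two]
  simp [LinearMap.toMatrix_apply, frameMap_apply, cross]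
  ring

theorem inner_eq (v w : Plane) : inner ℝ v w = v 0 * w 0 + v 1 * w 1 := by
  simp [PiLp.inner_apply, Fin.sum_univ_two, mul_comm]

theorem norm_sq_eq (v : Plane) : ‖v‖ ^ 2 = v 0 ^ 2 + v 1 ^ 2 := by
  rw [EuclideanSpace.real_norm_sq_eq, Fin.sum_univ_two]

/-- Linear change of variables with Jacobian `cross g d`. It is only an inequality because the
parallelogram need not fill `K`. -/
theorem lintegral_parallelogram_le (p g d : Plane) (hJ : cross g d ≠ 0) (a : ℝ) (K : Set Plane)
    (hK : MeasurableSet K)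
    (hmem : ∀ t ∈ Set.Icc 0 a, ∀ s ∈ Set.Icc (0 : ℝ) 1, p + t • g + s • d ∈ K)
    (Φ : Plane → ENNReal) (hΦ : Measurable Φ) :
    ∫⁻ t in Set.Icc 0 a, ∫⁻ s in Set.Icc (0 : ℝ) 1, Φ (p + t • g + s • d) ≤
      ENNReal.ofReal |(cross g d)⁻¹| * ∫⁻ x in K, Φ x := by
  set Ψ : Plane → ENNReal := K.indicator Φ with hΨ
  have hΨm : Measurable Ψ := hΦ.indicator hK
  have hΨp : Measurable (fun x => Ψ (p + x)) := hΨm.comp (measurable_const_add p)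
  have hfm : Measurable (frameMap g d) :=
    (LinearMap.continuous_of_finiteDimensional (frameMap g d)).measurable
  have h1 : ∫⁻ t in Set.Icc 0 a, ∫⁻ s in Set.Icc (0 : ℝ) 1, Φ (p + t • g + s • d) ≤
      ∫⁻ t : ℝ, ∫⁻ s : ℝ, Ψ (p + t • g + s • d) := by
    refine le_trans (setLIntegral_mono' measurableSet_Icc (g := fun t =>
      ∫⁻ s : ℝ, Ψ (p + t • g + s • d)) fun t ht => ?_) (setLIntegral_le_lintegral _ _)
    refine le_trans (setLIntegral_mono' measurableSet_Icc (g := fun s =>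
      Ψ (p + t • g + s • d)) fun s hs => ?_) (setLIntegral_le_lintegral _ _)
    rw [hΨ, Set.indicator_of_mem (hmem t ht s hs)]
  have hmap := Measure.map_linearMap_addHaar_eq_smul_addHaar (volume : Measure Plane)
    (f := frameMap g d) (by rwa [det_frameMap])
  have h2 : ∫⁻ t : ℝ, ∫⁻ s : ℝ, Ψ (p + t • g + s • d) =
      ∫⁻ x : Plane, Ψ (p + frameMap g d x) := by
    have e1 := (volume_preserving_finTwoArrow ℝ).lintegral_comp (f := fun q : ℝ × ℝ =>
      Ψ (p + q.1 • g + q.2 • d)) (by fun_prop)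
    have e2 := (PiLp.volume_preserving_ofLp (Fin 2)).lintegral_comp (f := fun q : Fin 2 → ℝ =>
      Ψ (p + q 0 • g + q 1 • d)) (by fun_prop)
    rw [Measure.volume_eq_prod, lintegral_prod _ (by fun_prop)] at e1
    rw [← e1]
    simp only [MeasurableEquiv.finTwoArrow_apply]
    rw [← e2]
    simp [frameMap_apply, add_assoc]
  refine h1.trans (le_of_eq ?_)
  rw [h2, ← lintegral_map (μ := volume) (f := fun x => Ψ (p + x)) hΨp hfm, hmap,
    lintegral_smul_measure, det_frameMap, lintegral_add_left_eq_self (μ := volume) Ψ p, hΨ,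
    lintegral_indicator hK, smul_eq_mul]

theorem convexHull_triangle_eq_image (a b c : Plane) :
    convexHull ℝ {a, b, c} = (fun x => a + x) '' (frameMap (b - a) (c - a) ''
      convexHull ℝ {0, EuclideanSpace.single 0 1, EuclideanSpace.single 1 1}) := by
  have h1 := (frameMap (b - a) (c - a)).image_convexHull
    {0, EuclideanSpace.single 0 1, EuclideanSpace.single 1 1}
  rw [h1]
  have h2 := (AffineEquiv.constVAdd ℝ Plane a).toAffineMap.image_convexHull
    (frameMap (b - a) (c - a) '' {0, EuclideanSpace.single 0 1, EuclideanSpace.single 1 1})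
  simp only [AffineEquiv.coe_toAffineMap, AffineEquiv.constVAdd_apply, vadd_eq_add] at h2
  rw [h2]
  congr 1
  simp [Set.image_insert_eq, frameMap_apply]

/-- Every triangle is an affine image of the reference triangle, whose area is left unevaluated:
only its positivity is needed. -/
theorem area_eq (a b c : Plane) : area {a, b, c} =
    area {0, EuclideanSpace.single 0 1, EuclideanSpace.single 1 1} * |cross (b - a) (c - a)| := by
  rw [area, convexHull_triangle_eq_image]
  rw [Set.image_add_left, measure_preimage_add, Measure.addHaar_image_linearMap, det_frameMap, area,
    ENNReal.toReal_mul, ENNReal.toReal_ofReal (abs_nonneg _), mul_comm]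

/-! ### Elements of a triangulation -/

namespace Triangulation

variable {Ω : Set Plane} (T : Triangulation Ω)

theorem exists_affineBasis {s : Set Plane} (hs : s ∈ T.elements) :
    ∃ b : AffineBasis (Fin 3) ℝ Plane, Set.range b = s := by
  obtain ⟨a, b, c, hI, rfl⟩ := T.nondegenerate s hs
  refine ⟨⟨![a, b, c], hI, ?_⟩, ?_⟩
  · rw [hI.affineSpan_eq_top_iff_card_eq_finrank_add_one]
    simp
  · change Set.range ![a, b, c] = _
    simp only [Matrix.range_cons, Matrix.range_empty, Set.union_empty]
    rfl

theorem interior_nonempty {s : Set Plane} (hs : s ∈ T.elements) :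
    (interior (convexHull ℝ s)).Nonempty := by
  obtain ⟨b, rfl⟩ := T.exists_affineBasis hs
  rw [interior_convexHull_nonempty_iff_affineSpan_eq_top]
  exact b.tot

theorem finite_vertices {s : Set Plane} (hs : s ∈ T.elements) : s.Finite := by
  obtain ⟨a, b, c, -, rfl⟩ := T.nondegenerate s hs
  simp

theorem isCompact_element {s : Set Plane} (hs : s ∈ T.elements) : IsCompact (convexHull ℝ s) :=
  (T.finite_vertices hs).isCompact_convexHull ℝ

theorem area_pos {s : Set Plane} (hs : s ∈ T.elements) : 0 < area s := by
  rw [area]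
  refine ENNReal.toReal_pos ?_ (T.isCompact_element hs).measure_ne_top
  exact (Measure.measure_pos_of_nonempty_interior _ (T.interior_nonempty hs)).ne'

theorem element_subset {s : Set Plane} (hs : s ∈ T.elements) : convexHull ℝ s ⊆ closure Ω := by
  rw [← T.cover]
  exact Set.subset_biUnion_of_mem (u := fun s => convexHull ℝ s) hs

theorem interior_subset (hΩ : interior (closure Ω) = Ω) {s : Set Plane} (hs : s ∈ T.elements) :
    interior (convexHull ℝ s) ⊆ Ω := by
  rw [← hΩ]
  exact interior_mono (T.element_subset hs)

theorem exists_mem_of_mem_closure {x : Plane} (hx : x ∈ closure Ω) :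
    ∃ s ∈ T.elements, x ∈ convexHull ℝ s := by
  rw [← T.cover] at hx
  simpa using hx

theorem affineSpan_sdiff_ne_top {s : Set Plane} (hs : s ∈ T.elements) {v : Plane} (hv : v ∈ s) :
    affineSpan ℝ (s \ {v}) ≠ ⊤ := by
  obtain ⟨b, rfl⟩ := T.exists_affineBasis hs
  obtain ⟨i, rfl⟩ := hv
  intro h
  have := b.ind.notMem_affineSpan_sdiff i Set.univ
  rw [Set.image_sdiff b.ind.injective, Set.image_univ, Set.image_singleton, h] at this
  exact this (AffineSubspace.mem_top ℝ Plane _)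

/-- By conformity the intersection is the hull of the common vertices. One of the triangles has a
vertex outside the other, so this hull is flat. -/
theorem disjoint_interior {s t : Set Plane} (hs : s ∈ T.elements) (ht : t ∈ T.elements)
    (hst : s ≠ t) : Disjoint (interior (convexHull ℝ s)) (interior (convexHull ℝ t)) := by
  have key : ∀ {s t : Set Plane}, s ∈ T.elements → t ∈ T.elements → ∀ v ∈ s, v ∉ t →
      interior (convexHull ℝ (s ∩ t)) = ∅ := by
    intro s t hs ht v hv hvt
    by_contra hne
    have h2 := interior_convexHull_nonempty_iff_affineSpan_eq_top.1
      (Set.nonempty_iff_ne_empty.2 hne)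
    refine T.affineSpan_sdiff_ne_top hs hv (top_unique ?_)
    rw [← h2]
    refine affineSpan_mono ℝ ?_
    rintro x ⟨hx, hx'⟩
    exact ⟨hx, fun h => hvt (h ▸ hx')⟩
  rw [Set.disjoint_iff_inter_eq_empty, ← interior_inter, T.conforming s hs t ht]
  by_cases h : s ⊆ t
  · obtain ⟨v, hv, hvs⟩ := Set.not_subset.1 fun h' => hst (h.antisymm h')
    rw [Set.inter_comm]
    exact key ht hs v hv hvs
  · obtain ⟨v, hv, hvs⟩ := Set.not_subset.1 h
    exact key hs ht v hv hvs

/-- The edges of a triangulation lie on finitely many lines. -/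
theorem exists_finite_lines : ∃ F : Set (Plane →ᵃ[ℝ] ℝ), F.Finite ∧ (∀ A ∈ F, A.linear ≠ 0) ∧
    ∀ x ∈ closure Ω, (∀ A ∈ F, A x ≠ 0) → ∃ s ∈ T.elements, x ∈ interior (convexHull ℝ s) := by
  have h : ∀ s ∈ T.elements, ∃ F : Set (Plane →ᵃ[ℝ] ℝ), F.Finite ∧ (∀ A ∈ F, A.linear ≠ 0) ∧
      ∀ x ∈ convexHull ℝ s, (∀ A ∈ F, A x ≠ 0) → x ∈ interior (convexHull ℝ s) := by
    intro s hs
    obtain ⟨b, rfl⟩ := T.exists_affineBasis hs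
    refine ⟨Set.range b.coord, Set.finite_range _, ?_, ?_⟩
    · rintro _ ⟨i, rfl⟩ h0
      obtain ⟨j, hj⟩ := exists_ne i
      have h1 := (b.coord i).linearMap_vsub (b i) (b j)
      rw [h0, AffineBasis.coord_apply_eq, AffineBasis.coord_apply_ne _ hj.symm] at h1
      simp at h1
    · intro x hx hF
      rw [AffineBasis.interior_convexHull]
      rw [AffineBasis.convexHull_eq_nonneg_coord] at hx
      exact fun i => lt_of_le_of_ne (hx i) (Ne.symm (hF _ ⟨i, rfl⟩))
  choose! F hF using h
  refine ⟨⋃ s ∈ T.elements, F s, T.finite.biUnion fun s hs => (hF s hs).1, ?_, ?_⟩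
  · intro A hA
    simp only [Set.mem_iUnion] at hA
    obtain ⟨s, hs, hA⟩ := hA
    exact (hF s hs).2.1 A hA
  · intro x hx hA
    obtain ⟨s, hs, hxs⟩ := T.exists_mem_of_mem_closure hx
    exact ⟨s, hs, (hF s hs).2.2 x hxs fun A hA' => hA A (Set.mem_biUnion hs hA')⟩

theorem ae_mem_interior : ∀ᵐ x : Plane, x ∈ closure Ω →
    ∃ s ∈ T.elements, x ∈ interior (convexHull ℝ s) := by
  have h : ∀ᵐ x : Plane, ∀ s ∈ T.elements, x ∉ frontier (convexHull ℝ s) := by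
    rw [ae_ball_iff T.finite.countable]
    intro s _
    exact measure_eq_zero_iff_ae_notMem.1 ((convex_convexHull ℝ s).addHaar_frontier volume)
  filter_upwards [h] with x hx hxΩ
  obtain ⟨s, hs, hxs⟩ := T.exists_mem_of_mem_closure hxΩ
  refine ⟨s, hs, ?_⟩
  by_contra hn
  exact hx s hs ⟨subset_closure hxs, hn⟩

/-- Almost every point of the closure is interior to an element, hence lies in `Ω` by regularity. So
energies may be computed over the closure. -/
theorem closure_ae_eq (T : Triangulation Ω) (hΩ : interior (closure Ω) = Ω) :
    (closure Ω : Set Plane) =ᵐ[volume] Ω := by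
  filter_upwards [T.ae_mem_interior] with x hx
  refine propext ⟨fun h => ?_, fun h => subset_closure h⟩
  obtain ⟨s, hs, hxs⟩ := hx h
  exact T.interior_subset hΩ hs hxs

theorem diam_le_meshSize {s : Set Plane} (hs : s ∈ T.elements) :
    Metric.diam (convexHull ℝ s) ≤ T.meshSize :=
  le_csSup (T.finite.image _).bddAbove ⟨s, hs, rfl⟩

theorem dist_le_meshSize {s : Set Plane} (hs : s ∈ T.elements) {x y : Plane}
    (hx : x ∈ convexHull ℝ s) (hy : y ∈ convexHull ℝ s) : dist x y ≤ T.meshSize :=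
  (Metric.dist_le_diam_of_mem (T.isCompact_element hs).isBounded hx hy).trans
    (T.diam_le_meshSize hs)

theorem meshSize_le (hΩ : Bornology.IsBounded Ω) : T.meshSize ≤ Metric.diam (closure Ω) := by
  refine Real.sSup_le ?_ Metric.diam_nonneg
  rintro _ ⟨s, hs, rfl⟩
  exact Metric.diam_mono (T.element_subset hs) hΩ.closure

theorem meshSize_pos {s : Set Plane} (hs : s ∈ T.elements) : 0 < T.meshSize := by
  obtain ⟨b, rfl⟩ := T.exists_affineBasis hs
  have h : b 0 ≠ b 1 := b.ind.injective.ne (by decide)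
  exact (dist_pos.2 h).trans_le (T.dist_le_meshSize hs
    (subset_convexHull ℝ _ ⟨0, rfl⟩) (subset_convexHull ℝ _ ⟨1, rfl⟩))

/-! ### Gradients of finite element functions -/

/-- `G s` is the gradient of `U` on the element `s`. -/
def IsElementGradient (U : Plane → ℝ) (G : Set Plane → Plane) : Prop :=
  ∀ s ∈ T.elements, ∀ x ∈ convexHull ℝ s, ∀ y ∈ convexHull ℝ s, U y - U x = inner ℝ (G s) (y - x)

theorem exists_isElementGradient {U : Plane → ℝ} (hU : U ∈ T.feSpace) :
    ∃ G, T.IsElementGradient U G := by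
  have h : ∀ s ∈ T.elements, ∃ G : Plane, ∀ x ∈ convexHull ℝ s, ∀ y ∈ convexHull ℝ s,
      U y - U x = inner ℝ G (y - x) := by
    intro s hs
    obtain ⟨A, hA⟩ := hU.2 s hs
    refine ⟨(InnerProductSpace.toDual ℝ Plane).symm (LinearMap.toContinuousLinearMap A.linear),
      fun x hx y hy => ?_⟩
    rw [hA x hx, hA y hy, InnerProductSpace.toDual_symm_apply]
    exact (A.linearMap_vsub y x).symm
  choose! G hG using h
  exact ⟨G, hG⟩

variable {T} {U : Plane → ℝ} {G : Set Plane → Plane}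

theorem quadratic_eq (x : Plane) : quadratic x = ‖x‖ ^ 2 := (norm_sq_eq x).symm

theorem IsElementGradient.hasGradientAt (hG : T.IsElementGradient U G) {s : Set Plane}
    (hs : s ∈ T.elements) {x : Plane} (hx : x ∈ interior (convexHull ℝ s)) :
    HasGradientAt (fun x => quadratic x - U x) ((2 : ℝ) • x - G s) x := by
  have hU : HasGradientAt (fun y => U x + inner ℝ (G s) (y - x)) (G s) x := by
    rw [hasGradientAt_iff_hasFDerivAt]
    have := ((innerSL ℝ (G s)).hasFDerivAt.comp x
      ((hasFDerivAt_id x).sub_const x)).const_add (U x)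
    convert! this using 1
  have hU' : HasGradientAt U (G s) x := by
    rw [hasGradientAt_iff_hasFDerivAt] at hU ⊢
    refine hU.congr_of_eventuallyEq ?_
    filter_upwards [isOpen_interior.mem_nhds hx] with y hy
    rw [← hG s hs x (_root_.interior_subset hx) y (_root_.interior_subset hy)]
    ring
  rw [hasGradientAt_iff_hasFDerivAt] at hU' ⊢
  have h2 := (hasStrictFDerivAt_norm_sq x).hasFDerivAt.sub hU'
  simp only [quadratic_eq]
  convert! h2 using 1
  ext y
  simp

theorem IsElementGradient.gradient_eq (hG : T.IsElementGradient U G) {s : Set Plane}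
    (hs : s ∈ T.elements) {x : Plane} (hx : x ∈ interior (convexHull ℝ s)) :
    gradient (fun x => quadratic x - U x) x = (2 : ℝ) • x - G s :=
  (hG.hasGradientAt hs hx).gradient

theorem measurable_gradient (f : Plane → ℝ) : Measurable (gradient f) :=
  (InnerProductSpace.toDual ℝ Plane).symm.continuous.measurable.comp (measurable_fderiv ℝ f)

theorem IsElementGradient.exists_bound (hG : T.IsElementGradient U G)
    (hΩ : Bornology.IsBounded Ω) : ∃ M, ∀ s ∈ T.elements, ∀ x ∈ interior (convexHull ℝ s),
      ‖gradient (fun x => quadratic x - U x) x‖ ≤ M := by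
  obtain ⟨R, hR⟩ := hΩ.closure.exists_norm_le
  obtain ⟨M, hM⟩ := (T.finite.image fun s => ‖G s‖).bddAbove
  refine ⟨2 * R + M, fun s hs x hx => ?_⟩
  rw [hG.gradient_eq hs hx]
  refine (norm_sub_le _ _).trans (add_le_add ?_ (hM ⟨s, hs, rfl⟩))
  rw [norm_smul]
  simpa using hR x (T.element_subset hs (_root_.interior_subset hx))

theorem IsElementGradient.integrableOn (hG : T.IsElementGradient U G)
    (hΩ : Bornology.IsBounded Ω) :
    IntegrableOn (fun x => ‖gradient (fun x => quadratic x - U x) x‖ ^ 2) (closure Ω) := by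
  obtain ⟨M, hM⟩ := hG.exists_bound hΩ
  refine Measure.integrableOn_of_bounded (M := M ^ 2)
    (Metric.isCompact_of_isClosed_isBounded isClosed_closure hΩ.closure).measure_ne_top
    ((measurable_gradient _).norm.pow_const 2).aestronglyMeasurable ?_
  rw [ae_restrict_iff' isClosed_closure.measurableSet]
  filter_upwards [T.ae_mem_interior] with x hx hxΩ
  obtain ⟨s, hs, hxs⟩ := hx hxΩ
  rw [Real.norm_of_nonneg (by positivity)]
  exact pow_le_pow_left₀ (norm_nonneg _) (hM s hs x hxs) 2

end Triangulation

namespace Triangulation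

variable {Ω : Set Plane} {T : Triangulation Ω} {U : Plane → ℝ} {G : Set Plane → Plane}

/-! ### The error along lines -/

theorem continuous_quadratic : Continuous quadratic := by
  simp only [funext quadratic_eq]
  fun_prop

/-- The variance of `φ` is nonnegative. -/
theorem sq_intervalIntegral_le {φ : ℝ → ℝ} (h1 : IntervalIntegrable φ volume 0 1)
    (h2 : IntervalIntegrable (fun s => φ s ^ 2) volume 0 1) :
    (∫ s in (0 : ℝ)..1, φ s) ^ 2 ≤ ∫ s in (0 : ℝ)..1, φ s ^ 2 := by
  set m := ∫ s in (0 : ℝ)..1, φ s with hm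
  have h3 : 0 ≤ ∫ s in (0 : ℝ)..1, (φ s - m) ^ 2 :=
    intervalIntegral.integral_nonneg zero_le_one fun s _ => sq_nonneg _
  have h4 : ∫ s in (0 : ℝ)..1, (φ s - m) ^ 2 =
      (∫ s in (0 : ℝ)..1, φ s ^ 2) - 2 * m * m + m ^ 2 := by
    have : ∀ s, (φ s - m) ^ 2 = φ s ^ 2 - 2 * m * φ s + m ^ 2 := fun s => by ring
    simp_rw [this]
    rw [intervalIntegral.integral_add (h2.sub (h1.const_mul _)) (by simp),
      intervalIntegral.integral_sub h2 (h1.const_mul _), intervalIntegral.integral_const_mul]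
    simp [hm]
  nlinarith

/-- The fundamental theorem of calculus on the segment from `p` to `p + d`, valid for continuous `f`
with countably many edge crossings excluded, followed by Cauchy-Schwarz. -/
theorem IsElementGradient.sq_sub_le_lintegral (hG : T.IsElementGradient U G)
    (hU : ContinuousOn U (closure Ω)) (hΩ : Bornology.IsBounded Ω) {p d : Plane}
    (hmem : ∀ s ∈ Set.Icc (0 : ℝ) 1, p + s • d ∈ closure Ω) {S : Set ℝ} (hS : S.Countable)
    (hgood : ∀ s ∈ Set.Icc (0 : ℝ) 1, s ∉ S → ∃ e ∈ T.elements,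
      p + s • d ∈ interior (convexHull ℝ e)) {f : Plane → ℝ}
    (hf : f = fun x => quadratic x - U x) :
    ENNReal.ofReal ((f (p + d) - f p) ^ 2) ≤
      ∫⁻ s in Set.Icc (0 : ℝ) 1, ENNReal.ofReal (‖d‖ ^ 2 * ‖gradient f (p + s • d)‖ ^ 2) := by
  obtain ⟨M, hM⟩ := hG.exists_bound hΩ
  rw [← hf] at hM
  have hline : Measurable fun s : ℝ => p + s • d := by fun_prop
  set φ : ℝ → ℝ := fun s => inner ℝ (gradient f (p + s • d)) d with hφ
  have hgm : Measurable fun s : ℝ => gradient f (p + s • d) := (measurable_gradient f).comp hline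
  have hφm : Measurable φ := hgm.inner measurable_const
  have hae : ∀ᵐ s : ℝ, s ∉ S := hS.ae_notMem volume
  have hφle : ∀ s, |φ s| ≤ ‖gradient f (p + s • d)‖ * ‖d‖ := fun s => abs_real_inner_le_norm _ _
  have hbd : ∀ᵐ s ∂(volume.restrict (Set.Icc (0 : ℝ) 1)), ‖gradient f (p + s • d)‖ ≤ M := by
    rw [ae_restrict_iff' measurableSet_Icc]
    filter_upwards [hae] with s hs hs'
    obtain ⟨e, he, hpe⟩ := hgood s hs' hs
    exact hM e he _ hpe
  have hfin : volume (Set.Icc (0 : ℝ) 1) ≠ ⊤ := isCompact_Icc.measure_ne_top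
  have i1 : IntegrableOn φ (Set.Icc (0 : ℝ) 1) := by
    refine Measure.integrableOn_of_bounded (M := M * ‖d‖) hfin hφm.aestronglyMeasurable ?_
    filter_upwards [hbd] with s hs
    exact (hφle s).trans (mul_le_mul_of_nonneg_right hs (norm_nonneg _))
  have i2 : IntegrableOn (fun s => φ s ^ 2) (Set.Icc (0 : ℝ) 1) := by
    refine Measure.integrableOn_of_bounded (M := (M * ‖d‖) ^ 2) hfin
      (hφm.pow_const 2).aestronglyMeasurable ?_
    filter_upwards [hbd] with s hs
    rw [Real.norm_of_nonneg (sq_nonneg _), ← sq_abs]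
    exact pow_le_pow_left₀ (abs_nonneg _)
      ((hφle s).trans (mul_le_mul_of_nonneg_right hs (norm_nonneg _))) 2
  have j1 : IntervalIntegrable φ volume 0 1 :=
    (intervalIntegrable_iff_integrableOn_Icc_of_le zero_le_one).2 i1
  have j2 : IntervalIntegrable (fun s => φ s ^ 2) volume 0 1 :=
    (intervalIntegrable_iff_integrableOn_Icc_of_le zero_le_one).2 i2
  have hcont : ContinuousOn (fun s : ℝ => f (p + s • d)) (Set.uIcc 0 1) := by
    rw [Set.uIcc_of_le zero_le_one, hf]
    exact (continuous_quadratic.comp (by fun_prop)).continuousOn.sub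
      (hU.comp (by fun_prop) hmem)
  have hderiv : ∀ s ∈ Set.Ioo (min (0 : ℝ) 1) (max 0 1) \ S,
      HasDerivAt (fun s : ℝ => f (p + s • d)) (φ s) s := by
    rintro s ⟨hs, hsS⟩
    rw [min_eq_left zero_le_one, max_eq_right zero_le_one] at hs
    obtain ⟨e, he, hpe⟩ := hgood s (Set.Ioo_subset_Icc_self hs) hsS
    have h1 := (hG.hasGradientAt he hpe).differentiableAt.hasGradientAt
    rw [← hf, hasGradientAt_iff_hasFDerivAt] at h1
    have h2 : HasDerivAt (fun s : ℝ => p + s • d) d s := by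
      simpa using ((hasDerivAt_id s).smul_const d).const_add p
    exact h1.comp_hasDerivAt s h2
  have hftc := integral_eq_of_hasDerivAt_off_countable _ φ hS hcont hderiv j1
  simp only [one_smul, zero_smul, add_zero] at hftc
  rw [← hftc]
  refine (ENNReal.ofReal_le_ofReal (sq_intervalIntegral_le j1 j2)).trans ?_
  rw [intervalIntegral.integral_of_le zero_le_one, ← integral_Icc_eq_integral_Ioc,
    ofReal_integral_eq_lintegral_ofReal i2 (ae_of_all _ fun s => sq_nonneg _)]
  refine lintegral_mono fun s => ENNReal.ofReal_le_ofReal ?_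
  rw [← sq_abs, ← mul_pow, mul_comm]
  exact pow_le_pow_left₀ (abs_nonneg _) (hφle s) 2

/-- Along almost every line of a parallel family only finitely many points lie on edges. -/
theorem finite_edge_crossings {F : Set (Plane →ᵃ[ℝ] ℝ)} (hF : F.Finite)
    (hlin : ∀ A ∈ F, A.linear ≠ 0) (p : Plane) {g d : Plane} (hJ : cross g d ≠ 0) :
    ∀ᵐ t : ℝ, {s : ℝ | ∃ A ∈ F, A (p + t • g + s • d) = 0}.Countable := by
  have hexp : ∀ (A : Plane →ᵃ[ℝ] ℝ) (t s : ℝ),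
      A (p + t • g + s • d) = A p + t * A.linear g + s * A.linear d := by
    intro A t s
    have h := A.linearMap_vsub (p + t • g + s • d) p
    rw [vsub_eq_sub, vsub_eq_sub, add_assoc, add_sub_cancel_left, map_add, map_smul, map_smul,
      smul_eq_mul, smul_eq_mul] at h
    rw [add_assoc]
    linarith
  have hspan : ∀ A ∈ F, A.linear d = 0 → A.linear g ≠ 0 := by
    intro A hA hd hg
    refine hlin A hA (LinearMap.ext fun x => ?_)
    have hx : cross g d • x = cross x d • g + cross g x • d := by
      ext i
      fin_cases i <;> simp [cross] <;> ring
    have := congrArg A.linear hx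
    rw [map_add, map_smul, map_smul, map_smul, hd, hg] at this
    simpa [hJ] using this
  -- An edge line parallel to `d` is met by the family for one value of `t` only; discarding these
  -- finitely many values leaves at most one crossing per edge line.
  have h0 : ∀ᵐ t : ℝ, ∀ A ∈ F, A.linear d = 0 → A p + t * A.linear g ≠ 0 := by
    rw [ae_ball_iff hF.countable]
    intro A hA
    by_cases hd : A.linear d = 0
    · have hg := hspan A hA hd
      have : ∀ᵐ t : ℝ, t ≠ - A p / A.linear g := by
        simpa using (Set.countable_singleton (- A p / A.linear g)).ae_notMem volume
      filter_upwards [this] with t ht _ h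
      exact ht (by field_simp; linarith)
    · exact ae_of_all _ fun t h => absurd h hd
  filter_upwards [h0] with t ht
  have : {s : ℝ | ∃ A ∈ F, A (p + t • g + s • d) = 0} ⊆
      (fun A : Plane →ᵃ[ℝ] ℝ => -(A p + t * A.linear g) / A.linear d) '' F := by
    rintro s ⟨A, hA, h⟩
    refine ⟨A, hA, ?_⟩
    rw [hexp] at h
    by_cases hd : A.linear d = 0
    · exact absurd (by simpa [hd] using h) (ht A hA hd)
    · field_simp
      linarith
  exact (hF.image _).countable.mono this

/-- Averaging the one-segment bound over a parallel family turns line integrals of the gradient into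
the energy over a parallelogram. -/
theorem IsElementGradient.lintegral_sq_sub_le (hG : T.IsElementGradient U G)
    (hU : ContinuousOn U (closure Ω)) (hΩ : Bornology.IsBounded Ω)
    (hreg : interior (closure Ω) = Ω) {p g d : Plane} (hJ : cross g d ≠ 0) {a : ℝ}
    (hmem : ∀ t ∈ Set.Icc 0 a, ∀ s ∈ Set.Icc (0 : ℝ) 1, p + t • g + s • d ∈ closure Ω)
    {f : Plane → ℝ} (hf : f = fun x => quadratic x - U x) :
    ∫⁻ t in Set.Icc 0 a, ENNReal.ofReal ((f (p + t • g + d) - f (p + t • g)) ^ 2) ≤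
      ENNReal.ofReal (‖d‖ ^ 2 * |(cross g d)⁻¹| * h1Seminorm Ω f ^ 2) := by
  obtain ⟨F, hF, hlin, hgood⟩ := T.exists_finite_lines
  have hint := hG.integrableOn hΩ
  rw [← hf] at hint
  have h1 : ∫⁻ t in Set.Icc 0 a, ENNReal.ofReal ((f (p + t • g + d) - f (p + t • g)) ^ 2) ≤
      ∫⁻ t in Set.Icc 0 a, ∫⁻ s in Set.Icc (0 : ℝ) 1,
        ENNReal.ofReal (‖d‖ ^ 2 * ‖gradient f (p + t • g + s • d)‖ ^ 2) := by
    refine lintegral_mono_ae ?_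
    rw [ae_restrict_iff' measurableSet_Icc]
    filter_upwards [finite_edge_crossings hF hlin p hJ] with t hc ht
    refine hG.sq_sub_le_lintegral hU hΩ (hmem t ht) hc (fun s hs hsS => ?_) hf
    refine hgood _ (hmem t ht s hs) fun A hA h0 => hsS ⟨A, hA, h0⟩
  refine h1.trans ((lintegral_parallelogram_le p g d hJ a (closure Ω)
    isClosed_closure.measurableSet hmem
    (fun x => ENNReal.ofReal (‖d‖ ^ 2 * ‖gradient f x‖ ^ 2)) ?_).trans (le_of_eq ?_))
  · exact (((measurable_gradient f).norm.pow_const 2).const_mul _).ennreal_ofReal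
  · rw [← ofReal_integral_eq_lintegral_ofReal (hint.const_mul _)
      (ae_of_all _ fun x => by positivity), ← ENNReal.ofReal_mul (abs_nonneg _),
      integral_const_mul, setIntegral_congr_set (T.closure_ae_eq hreg), h1Seminorm, Real.sq_sqrt
        (integral_nonneg fun x => by positivity)]
    ring_nf

theorem sum_four_sq (a b c d : ℝ) :
    (a + b + c + d) ^ 2 ≤ 4 * (a ^ 2 + b ^ 2 + c ^ 2 + d ^ 2) := by
  nlinarith [sq_nonneg (a - b), sq_nonneg (a - c), sq_nonneg (a - d), sq_nonneg (b - c),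
    sq_nonneg (b - d), sq_nonneg (c - d)]

theorem lintegral_const_mul_add_four {μ : Measure ℝ} {F₁ F₂ F₃ F₄ : ℝ → ENNReal}
    (h₁ : AEMeasurable F₁ μ) (h₂ : AEMeasurable F₂ μ) (h₃ : AEMeasurable F₃ μ)
    (h₄ : AEMeasurable F₄ μ) (c : ENNReal) :
    ∫⁻ t, c * (F₁ t + F₂ t + F₃ t + F₄ t) ∂μ =
      c * ((∫⁻ t, F₁ t ∂μ) + (∫⁻ t, F₂ t ∂μ) + (∫⁻ t, F₃ t ∂μ) + ∫⁻ t, F₄ t ∂μ) := by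
  rw [lintegral_const_mul'' _ (by fun_prop), lintegral_add_left' (by fun_prop),
    lintegral_add_left' (by fun_prop), lintegral_add_left' (by fun_prop)]

/-- If the second differences of the error on a segment in a convex part of the domain are bounded
below, then so is the error. -/
theorem IsElementGradient.pow_five_le (hG : T.IsElementGradient U G)
    (hU : ContinuousOn U (closure Ω)) (hΩ : Bornology.IsBounded Ω)
    (hreg : interior (closure Ω) = Ω) {K : Set Plane} (hK : Convex ℝ K) (hKΩ : K ⊆ closure Ω)
    {p g z : Plane} {δ : ℝ} (hδ : 0 ≤ δ) (hp : p ∈ K) (hq : p + (3 * δ) • g ∈ K) (hz : z ∈ K)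
    (hJ : cross g (z - p) ≠ 0) {f : Plane → ℝ} (hf : f = fun x => quadratic x - U x)
    (hΔ : ∀ t ∈ Set.Icc 0 δ, δ ^ 2 ≤
      |f (p + t • g) - 2 * f (p + (t + δ) • g) + f (p + (t + 2 * δ) • g)|) :
    δ ^ 5 ≤ 48 * Metric.diam (closure Ω) ^ 2 * |(cross g (z - p))⁻¹| * h1Seminorm Ω f ^ 2 := by
  set D := Metric.diam (closure Ω) with hD
  -- Going one third of the way to `z` keeps `p + t • g + d₁` in the convex set for `t ≤ 2δ`, as the
  -- base has length `3δ`. The shift `d₂` reaches the same point from the base point `δ` further on.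
  set d₁ : Plane := (1 / 3 : ℝ) • (z - p) with hd₁
  set d₂ : Plane := d₁ - δ • g with hd₂
  have hc₁ : cross g d₁ = cross g (z - p) / 3 := by simp [cross, hd₁]; ring
  have hc₂ : cross g d₂ = cross g (z - p) / 3 := by
    rw [← hc₁]; simp [cross, hd₂]; ring
  have hcol : ∀ t ∈ Set.Icc 0 (3 * δ), p + t • g ∈ K := by
    intro t ht
    rcases hδ.eq_or_lt with h0 | h0
    · have : t = 0 := by rw [← h0] at ht; linarith [ht.1, ht.2]
      simpa [this] using hp
    · have := hK hp hq (a := 1 - t / (3 * δ)) (b := t / (3 * δ))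
        (by rw [sub_nonneg, div_le_one (by positivity)]; exact ht.2)
        (div_nonneg ht.1 (by positivity)) (by ring)
      convert! this using 1
      rw [smul_add, smul_smul, div_mul_cancel₀ _ (by positivity), sub_smul, one_smul]
      abel
  have htop : ∀ t ∈ Set.Icc 0 (2 * δ), p + t • g + d₁ ∈ K := by
    intro t ht
    have := hK (hcol (3 / 2 * t) ⟨by linarith [ht.1], by linarith [ht.2]⟩) hz
      (a := 2 / 3) (b := 1 / 3) (by norm_num) (by norm_num) (by norm_num)
    convert! this using 1
    rw [hd₁]
    module
  have hseg : ∀ x d : Plane, x ∈ K → x + d ∈ K → ∀ s ∈ Set.Icc (0 : ℝ) 1, x + s • d ∈ K := by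
    intro x d hx hxd s hs
    have := hK hx hxd (a := 1 - s) (b := s) (by linarith [hs.2]) hs.1 (by ring)
    convert! this using 1
    module
  have hnorm : ∀ x d : Plane, x ∈ K → x + d ∈ K → ‖d‖ ^ 2 ≤ D ^ 2 := by
    intro x d hx hxd
    have := Metric.dist_le_diam_of_mem hΩ.closure (hKΩ hxd) (hKΩ hx)
    rw [dist_eq_norm, add_sub_cancel_left] at this
    exact pow_le_pow_left₀ (norm_nonneg _) this 2
  have hfc : ContinuousOn f (closure Ω) := by
    rw [hf]
    exact continuous_quadratic.continuousOn.sub hU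
  have est : ∀ (τ : ℝ) (d : Plane), cross g d = cross g (z - p) / 3 →
      (∀ t ∈ Set.Icc 0 δ, p + (t + τ) • g ∈ K ∧ p + (t + τ) • g + d ∈ K) →
      AEMeasurable (fun t => ENNReal.ofReal ((f (p + (t + τ) • g + d) - f (p + (t + τ) • g)) ^ 2))
        (volume.restrict (Set.Icc 0 δ)) ∧
      ∫⁻ t in Set.Icc 0 δ, ENNReal.ofReal ((f (p + (t + τ) • g + d) - f (p + (t + τ) • g)) ^ 2) ≤
      ENNReal.ofReal (3 * D ^ 2 * |(cross g (z - p))⁻¹| * h1Seminorm Ω f ^ 2) := by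
    intro τ d hc hm
    refine ⟨?_, ?_⟩
    · have c1 : ContinuousOn (fun t : ℝ => f (p + (t + τ) • g + d)) (Set.Icc 0 δ) :=
        hfc.comp (by fun_prop) fun t ht => hKΩ (hm t ht).2
      have c2 : ContinuousOn (fun t : ℝ => f (p + (t + τ) • g)) (Set.Icc 0 δ) :=
        hfc.comp (by fun_prop) fun t ht => hKΩ (hm t ht).1
      exact (((c1.sub c2).pow 2).aemeasurable measurableSet_Icc).ennreal_ofReal
    have hre : ∀ t : ℝ, p + (t + τ) • g = p + τ • g + t • g := fun t => by module
    simp only [hre] at hm ⊢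
    refine (hG.lintegral_sq_sub_le hU hΩ hreg (p := p + τ • g) (d := d)
      (by rw [hc]; exact div_ne_zero hJ three_ne_zero)
      (fun t ht s hs => hKΩ (hseg _ _ (hm t ht).1 (hm t ht).2 s hs)) hf).trans
      (ENNReal.ofReal_le_ofReal ?_)
    refine mul_le_mul_of_nonneg_right ?_ (sq_nonneg _)
    have h0 := hm 0 ⟨le_rfl, hδ⟩
    rw [hc, inv_div, div_eq_mul_inv, abs_mul, abs_of_pos (by norm_num : (0 : ℝ) < 3)]
    have := mul_le_mul_of_nonneg_right (hnorm _ _ h0.1 h0.2) (abs_nonneg (cross g (z - p))⁻¹)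
    linarith
  have hback : ∀ t : ℝ, p + (t + δ) • g + d₂ = p + t • g + d₁ := fun t => by rw [hd₂]; module
  obtain ⟨m1, e1⟩ := est 0 d₁ hc₁ fun t ht => by
    rw [add_zero]
    exact ⟨hcol t ⟨ht.1, by linarith [ht.2]⟩, htop t ⟨ht.1, by linarith [ht.2]⟩⟩
  obtain ⟨m2, e2⟩ := est δ d₂ hc₂ fun t ht =>
    ⟨hcol _ ⟨by linarith [ht.1], by linarith [ht.2]⟩, by
      rw [hback]; exact htop t ⟨ht.1, by linarith [ht.2]⟩⟩
  obtain ⟨m3, e3⟩ := est δ d₁ hc₁ fun t ht =>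
    ⟨hcol _ ⟨by linarith [ht.1], by linarith [ht.2]⟩,
      htop _ ⟨by linarith [ht.1], by linarith [ht.2]⟩⟩
  obtain ⟨m4, e4⟩ := est (2 * δ) d₂ hc₂ fun t ht =>
    ⟨hcol _ ⟨by linarith [ht.1], by linarith [ht.2]⟩, by
      rw [show t + 2 * δ = t + δ + δ by ring, hback]
      exact htop _ ⟨by linarith [ht.1], by linarith [ht.2]⟩⟩
  set B := 3 * D ^ 2 * |(cross g (z - p))⁻¹| * h1Seminorm Ω f ^ 2 with hB
  have hB0 : 0 ≤ B := by positivity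
  have key : ENNReal.ofReal (δ ^ 5) ≤ ENNReal.ofReal (16 * B) := by
    calc ENNReal.ofReal (δ ^ 5) = ∫⁻ t in Set.Icc 0 δ, ENNReal.ofReal (δ ^ 4) := by
          rw [setLIntegral_const, Real.volume_Icc, sub_zero, ← ENNReal.ofReal_mul (by positivity)]
          ring_nf
      _ ≤ ∫⁻ t in Set.Icc 0 δ, ENNReal.ofReal 4 *
          (ENNReal.ofReal ((f (p + (t + 0) • g + d₁) - f (p + (t + 0) • g)) ^ 2) +
          ENNReal.ofReal ((f (p + (t + δ) • g + d₂) - f (p + (t + δ) • g)) ^ 2) +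
          ENNReal.ofReal ((f (p + (t + δ) • g + d₁) - f (p + (t + δ) • g)) ^ 2) +
          ENNReal.ofReal ((f (p + (t + 2 * δ) • g + d₂) - f (p + (t + 2 * δ) • g)) ^ 2)) := by
          refine setLIntegral_mono_ae' measurableSet_Icc (ae_of_all _ fun t ht => ?_)
          rw [← ENNReal.ofReal_add (sq_nonneg _) (sq_nonneg _),
            ← ENNReal.ofReal_add (by positivity) (sq_nonneg _),
            ← ENNReal.ofReal_add (by positivity) (sq_nonneg _),
            ← ENNReal.ofReal_mul (by norm_num)]
          refine ENNReal.ofReal_le_ofReal ?_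
          have h1 := pow_le_pow_left₀ (by positivity) (hΔ t ht) 2
          rw [sq_abs, ← pow_mul] at h1
          -- With these signs the values of `f` at the displaced points cancel by `hback`, leaving
          -- the second difference on the base.
          have h2 := sum_four_sq (-(f (p + (t + 0) • g + d₁) - f (p + (t + 0) • g)))
            (f (p + (t + δ) • g + d₂) - f (p + (t + δ) • g))
            (f (p + (t + δ) • g + d₁) - f (p + (t + δ) • g))
            (-(f (p + (t + 2 * δ) • g + d₂) - f (p + (t + 2 * δ) • g)))
          rw [neg_sq, neg_sq] at h2
          refine (h1.trans (le_of_eq ?_)).trans h2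
          have h3 : p + (t + 2 * δ) • g + d₂ = p + (t + δ) • g + d₁ := by
            rw [← hback (t + δ), show t + 2 * δ = t + δ + δ by ring]
          rw [h3, hback, add_zero]
          ring
      _ ≤ ENNReal.ofReal (16 * B) := by
          refine (lintegral_const_mul_add_four m1 m2 m3 m4 _).le.trans ?_
          refine (mul_le_mul_right (add_le_add (add_le_add (add_le_add e1 e2) e3) e4) _).trans ?_
          rw [← ENNReal.ofReal_add hB0 hB0, ← ENNReal.ofReal_add (by positivity) hB0,
            ← ENNReal.ofReal_add (by positivity) hB0, ← ENNReal.ofReal_mul (by norm_num)]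
          exact ENNReal.ofReal_le_ofReal (by linarith)
  have := (ENNReal.ofReal_le_ofReal_iff (by positivity)).1 key
  rw [hB] at this
  linarith

end Triangulation

/-! ### Finite sequences -/

theorem sum_succ_sub_castSucc {n : ℕ} (t : Fin (n + 1) → ℝ) :
    ∑ i : Fin n, (t i.succ - t i.castSucc) = t (Fin.last n) - t 0 := by
  induction n with
  | zero => simp
  | succ n ih =>
    rw [Fin.sum_univ_castSucc]
    have := ih fun i => t i.castSucc
    simp only [Fin.succ_castSucc, Fin.castSucc_zero] at this ⊢
    rw [this, Fin.succ_last]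
    ring

theorem abs_sub_zero_le_sum {n : ℕ} (a : Fin (n + 1) → ℝ) (i : Fin (n + 1)) :
    |a i - a 0| ≤ ∑ j : Fin n, |a j.succ - a j.castSucc| := by
  induction n with
  | zero => fin_cases i; simp
  | succ n ih =>
    rw [Fin.sum_univ_castSucc]
    have h := ih fun i => a i.castSucc
    simp only [Fin.succ_castSucc, Fin.castSucc_zero] at h ⊢
    refine Fin.lastCases ?_ (fun i => ?_) i
    · have h1 := h (Fin.last n)
      have h2 := abs_sub_le (a (Fin.last (n + 1))) (a (Fin.last n).castSucc) (a 0)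
      rw [Fin.succ_last]
      linarith
    · have := h i
      have h3 := abs_nonneg (a (Fin.last n).succ - a (Fin.last n).castSucc)
      linarith

theorem exists_mem_Ico {n : ℕ} (t : Fin (n + 1) → ℝ) {x : ℝ} (h0 : t 0 ≤ x)
    (h1 : x < t (Fin.last n)) : ∃ i : Fin n, t i.castSucc ≤ x ∧ x < t i.succ := by
  induction n with
  | zero => exact absurd (h0.trans_lt h1) (by simp)
  | succ n ih =>
    by_cases h : t (Fin.last n).castSucc ≤ x
    · exact ⟨Fin.last n, h, by rwa [Fin.succ_last]⟩
    · obtain ⟨i, hi⟩ := ih (fun i => t i.castSucc) (by simpa using h0) (not_le.1 h)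
      exact ⟨i.castSucc, by simpa using hi⟩

/-! ### Slopes along a band -/

namespace Band

variable {Ω : Set Plane} {T : Triangulation Ω} {N : ℕ} (B : Band T N)

theorem exists_param : ∃ g : Plane, ‖g‖ = 1 ∧ ∃ t : Fin (N + 2) → ℝ, StrictMono t ∧ t 0 = 0 ∧
    t (Fin.last _) = B.length ∧ ∀ i, B.P i = B.P 0 + t i • g := by
  obtain ⟨g, hg, t, ht, hP⟩ := B.straight
  have h0 : t 0 = 0 := by
    have h := hP 0
    have hg0 : g ≠ 0 := by rintro rfl; simp at hg
    simpa [hg0] using h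
  refine ⟨g, hg, t, ht, h0, ?_, hP⟩
  have h := sum_succ_sub_castSucc t
  rw [h0, sub_zero] at h
  rw [← h, length]
  refine Finset.sum_congr rfl fun i _ => ?_
  rw [hP i.succ, hP i.castSucc, dist_comm, dist_eq_norm, add_sub_add_left_eq_sub, ← sub_smul,
    norm_smul, hg, mul_one, Real.norm_of_nonneg (sub_nonneg.2 (ht.monotone
      (Fin.castSucc_lt_succ (i := i)).le))]

variable {B} {U : Plane → ℝ} {G : Set Plane → Plane} {g : Plane} {t : Fin (N + 2) → ℝ}

theorem mem_convexHull_K (hP : ∀ i, B.P i = B.P 0 + t i • g) {i : Fin (N + 1)} {x : ℝ}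
    (h0 : t i.castSucc ≤ x) (h1 : x ≤ t i.succ) (hlt : t i.castSucc < t i.succ) :
    B.P 0 + x • g ∈ convexHull ℝ (B.K i) := by
  have m1 : B.P i.castSucc ∈ convexHull ℝ (B.K i) := subset_convexHull ℝ _ (by simp [K])
  have m2 : B.P i.succ ∈ convexHull ℝ (B.K i) := subset_convexHull ℝ _ (by simp [K])
  have hpos : 0 < t i.succ - t i.castSucc := sub_pos.2 hlt
  have := convex_convexHull ℝ (B.K i) m1 m2
    (a := (t i.succ - x) / (t i.succ - t i.castSucc))
    (b := (x - t i.castSucc) / (t i.succ - t i.castSucc))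
    (div_nonneg (by linarith) hpos.le) (div_nonneg (by linarith) hpos.le)
    (by rw [← add_div, div_eq_one_iff_eq hpos.ne']; ring)
  convert! this using 1
  rw [hP i.succ, hP i.castSucc, smul_add, smul_add, smul_smul, smul_smul]
  have e1 : (t i.succ - x) / (t i.succ - t i.castSucc) +
      (x - t i.castSucc) / (t i.succ - t i.castSucc) = 1 := by
    rw [← add_div, div_eq_one_iff_eq hpos.ne']; ring
  have e2 : (t i.succ - x) / (t i.succ - t i.castSucc) * t i.castSucc +
      (x - t i.castSucc) / (t i.succ - t i.castSucc) * t i.succ = x := by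
    field_simp
    ring
  calc B.P 0 + x • g = ((t i.succ - x) / (t i.succ - t i.castSucc) +
      (x - t i.castSucc) / (t i.succ - t i.castSucc)) • B.P 0 +
      ((t i.succ - x) / (t i.succ - t i.castSucc) * t i.castSucc +
      (x - t i.castSucc) / (t i.succ - t i.castSucc) * t i.succ) • g := by
        rw [e1, e2, one_smul]
    _ = _ := by module

/-- The total variation of the tangential derivative of `U` along the band. -/
noncomputable def slopeVariation (B : Band T N) (G : Set Plane → Plane) (g : Plane) : ℝ :=
  ∑ i : Fin N, |inner ℝ (G (B.K i.succ)) g - inner ℝ (G (B.K i.castSucc)) g|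

theorem mem_closure_of_mem_Icc (ht : StrictMono t) (h0 : t 0 = 0)
    (hL : t (Fin.last _) = B.length) (hP : ∀ i, B.P i = B.P 0 + t i • g) {x : ℝ}
    (hx : x ∈ Set.Icc 0 B.length) : B.P 0 + x • g ∈ closure Ω := by
  rcases hx.2.eq_or_lt with h | h
  · refine T.element_subset (B.mem_K (Fin.last N)) (mem_convexHull_K hP ?_ ?_ ?_)
    · rw [h, ← hL]; exact ht.monotone (Fin.le_last _)
    · rw [h, ← hL, Fin.succ_last]
    · exact ht (Fin.castSucc_lt_succ)
  · rw [← h0, ← hL] at *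
    obtain ⟨i, hi1, hi2⟩ := exists_mem_Ico t hx.1 h
    exact T.element_subset (B.mem_K i)
      (mem_convexHull_K hP hi1 hi2.le (hi1.trans_lt hi2))

/-- Mean value inequality for `U` minus the linear function with the slope of `K 0`: its right
derivative on each half-open cell is a difference of two slopes, at most the total variation. -/
theorem abs_sub_sub_le (hG : T.IsElementGradient U G) (hU : ContinuousOn U (closure Ω))
    (ht : StrictMono t) (h0 : t 0 = 0) (hL : t (Fin.last _) = B.length)
    (hP : ∀ i, B.P i = B.P 0 + t i • g) {x y : ℝ} (hx : 0 ≤ x) (hxy : x ≤ y)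
    (hy : y ≤ B.length) :
    |U (B.P 0 + y • g) - U (B.P 0 + x • g) - inner ℝ (G (B.K 0)) g * (y - x)| ≤
      B.slopeVariation G g * (y - x) := by
  set a : Fin (N + 1) → ℝ := fun i => inner ℝ (G (B.K i)) g with ha
  have hex : ∀ w ∈ Set.Ico x y, ∃ i : Fin (N + 1), t i.castSucc ≤ w ∧ w < t i.succ := by
    intro w hw
    exact exists_mem_Ico t (by rw [h0]; exact hx.trans hw.1) (by rw [hL]; exact hw.2.trans_le hy)
  choose! i hi using hex
  have h := norm_image_sub_le_of_norm_deriv_right_le_segment (a := x) (b := y)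
    (f := fun w => U (B.P 0 + w • g) - a 0 * w) (f' := fun w => a (i w) - a 0)
    (C := B.slopeVariation G g) ?_ ?_ ?_ y ⟨hxy, le_rfl⟩
  · rw [Real.norm_eq_abs] at h
    convert! h using 2
    ring
  · refine ContinuousOn.sub (hU.comp (by fun_prop) fun w hw => ?_) (by fun_prop)
    exact mem_closure_of_mem_Icc ht h0 hL hP ⟨hx.trans hw.1, hw.2.trans hy⟩
  · intro w hw
    obtain ⟨h1, h2⟩ := hi w hw
    have hd : HasDerivWithinAt (fun y => U (B.P 0 + w • g) + a (i w) * (y - w) - a 0 * y)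
        (a (i w) - a 0) (Set.Ici w) w := by
      have := ((((hasDerivAt_id w).sub_const w).const_mul (a (i w))).const_add
        (U (B.P 0 + w • g))).sub ((hasDerivAt_id w).const_mul (a 0))
      convert! this.hasDerivWithinAt using 1
      simp
    refine hd.congr_of_eventuallyEq ?_ (by simp)
    have hev : ∀ᶠ v in 𝓝[≥] w, v < t (i w).succ :=
      eventually_nhdsWithin_of_eventually_nhds (eventually_lt_nhds h2)
    filter_upwards [hev, self_mem_nhdsWithin] with v hv hwv
    have := hG _ (B.mem_K (i w)) _ (mem_convexHull_K hP h1 h2.le (h1.trans_lt h2)) _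
      (mem_convexHull_K hP (h1.trans hwv) hv.le (h1.trans_lt h2))
    rw [add_sub_add_left_eq_sub, ← sub_smul, real_inner_smul_right] at this
    have e : a (i w) = inner ℝ (G (B.K (i w))) g := rfl
    rw [e]
    simp only [K] at this ⊢
    linarith
  · intro w hw
    exact abs_sub_zero_le_sum a (i w)

/-- The quadratic contributes exactly `2δ²`. Both increments of `U` equal the same reference slope
times `δ` up to `δ²/2`, so at most `δ²` is lost. -/
theorem sq_le_abs_second_difference (hG : T.IsElementGradient U G)
    (hU : ContinuousOn U (closure Ω)) (hg : ‖g‖ = 1)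
    (ht : StrictMono t) (h0 : t 0 = 0) (hL : t (Fin.last _) = B.length)
    (hP : ∀ i, B.P i = B.P 0 + t i • g) {x δ : ℝ} (hx : 0 ≤ x) (hδ : 0 ≤ δ)
    (hy : x + 2 * δ ≤ B.length) (hS : B.slopeVariation G g ≤ δ / 2)
    {f : Plane → ℝ} (hf : f = fun x => quadratic x - U x) :
    δ ^ 2 ≤ |f (B.P 0 + x • g) - 2 * f (B.P 0 + (x + δ) • g) + f (B.P 0 + (x + 2 * δ) • g)| := by
  have h1 := abs_le.1 (abs_sub_sub_le hG hU ht h0 hL hP hx (y := x + δ) (by linarith)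
    (by linarith))
  have h2 := abs_le.1 (abs_sub_sub_le hG hU ht h0 hL hP (x := x + δ) (y := x + 2 * δ)
    (by linarith) (by linarith) hy)
  have hgg : inner ℝ g g = (1 : ℝ) := by rw [real_inner_self_eq_norm_sq, hg]; norm_num
  have hq : ∀ s : ℝ, quadratic (B.P 0 + s • g) =
      ‖B.P 0‖ ^ 2 + 2 * s * inner ℝ (B.P 0) g + s ^ 2 := by
    intro s
    rw [Triangulation.quadratic_eq, norm_add_sq_real, norm_smul, hg, real_inner_smul_right,
      Real.norm_eq_abs, mul_one, sq_abs]
    ring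
  rw [hf]
  simp only [hq]
  refine le_trans ?_ (le_abs_self _)
  have hb : B.slopeVariation G g * δ ≤ δ / 2 * δ := mul_le_mul_of_nonneg_right hS hδ
  have r1 : x + δ - x = δ := by ring
  have r2 : x + 2 * δ - (x + δ) = δ := by ring
  rw [r1] at h1
  rw [r2] at h2
  nlinarith [h1.1, h1.2, h2.1, h2.2]

end Band

/-! ### Convex pieces of the domain and the lower bound for the slope variation -/

/-- A triangle with all three vertices close to one line would have too small an area. -/
theorem exists_vertex_far {a b c : Plane} (h : cross (b - a) (c - a) ≠ 0) :
    ∃ ρ > 0, ∀ g p : Plane, ‖g‖ = 1 → ∃ z ∈ ({a, b, c} : Set Plane), ρ ≤ |cross g (z - p)| := by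
  have hD : 0 < ‖b - a‖ + ‖c - a‖ := by
    by_contra hn
    have h1 : ‖b - a‖ = 0 := by linarith [norm_nonneg (b - a), norm_nonneg (c - a)]
    rw [norm_eq_zero] at h1
    exact h (by simp [h1, cross])
  refine ⟨|cross (b - a) (c - a)| / (2 * (‖b - a‖ + ‖c - a‖)),
    div_pos (abs_pos.2 h) (by positivity), fun g p hg => ?_⟩
  set ρ := |cross (b - a) (c - a)| / (2 * (‖b - a‖ + ‖c - a‖)) with hρ
  by_contra! hn
  have ha := hn a (by simp)
  have hb := hn b (by simp)
  have hc := hn c (by simp)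
  have hab : |cross g (b - a)| < 2 * ρ := by
    have : cross g (b - a) = cross g (b - p) - cross g (a - p) := by simp [cross]; ring
    rw [this]
    exact (abs_sub _ _).trans_lt (by linarith)
  have hac : |cross g (c - a)| < 2 * ρ := by
    have : cross g (c - a) = cross g (c - p) - cross g (a - p) := by simp [cross]; ring
    rw [this]
    exact (abs_sub _ _).trans_lt (by linarith)
  -- Expansion of the cross product in the orthonormal frame formed by `g` and its rotation by a
  -- right angle.
  have hid : cross (b - a) (c - a) =
      inner ℝ g (b - a) * cross g (c - a) - cross g (b - a) * inner ℝ g (c - a) := by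
    have hg2 : g 0 ^ 2 + g 1 ^ 2 = 1 := by rw [← norm_sq_eq, hg]; norm_num
    have : cross (b - a) (c - a) = (g 0 ^ 2 + g 1 ^ 2) * cross (b - a) (c - a) := by
      rw [hg2, one_mul]
    rw [this, inner_eq, inner_eq, cross, cross, cross]
    ring
  have i1 : |inner ℝ g (b - a)| ≤ ‖b - a‖ := by
    simpa [hg] using abs_real_inner_le_norm g (b - a)
  have i2 : |inner ℝ g (c - a)| ≤ ‖c - a‖ := by
    simpa [hg] using abs_real_inner_le_norm g (c - a)
  have hρ0 : 0 ≤ ρ := by positivity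
  have h1 : |cross (b - a) (c - a)| ≤
      ‖b - a‖ * |cross g (c - a)| + |cross g (b - a)| * ‖c - a‖ := by
    rw [hid]
    refine (abs_sub _ _).trans ?_
    rw [abs_mul, abs_mul]
    exact add_le_add (mul_le_mul_of_nonneg_right i1 (abs_nonneg _))
      (mul_le_mul_of_nonneg_left i2 (abs_nonneg _))
  have h2 : |cross (b - a) (c - a)| = 2 * ρ * (‖b - a‖ + ‖c - a‖) := by
    rw [hρ]; field_simp
  rcases (norm_nonneg (b - a)).eq_or_lt with hz | hz
  · nlinarith [norm_nonneg (c - a)]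
  · nlinarith [norm_nonneg (c - a)]

namespace Triangulation

variable {Ω : Set Plane}

theorem exists_uniform_far (T : Triangulation Ω) : ∃ ρ > 0, ∀ s ∈ T.elements, ∀ g p : Plane,
    ‖g‖ = 1 → ∃ z ∈ s, ρ ≤ |cross g (z - p)| := by
  have h : ∀ s ∈ T.elements, ∃ ρ > 0, ∀ g p : Plane, ‖g‖ = 1 → ∃ z ∈ s, ρ ≤ |cross g (z - p)| := by
    intro s hs
    have hpos := T.area_pos hs
    obtain ⟨a, b, c, -, rfl⟩ := T.nondegenerate s hs
    refine exists_vertex_far fun h0 => ?_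
    rw [area_eq, h0] at hpos
    simp at hpos
  choose! ρ hρ using h
  rcases T.elements.eq_empty_or_nonempty with he | hne
  · exact ⟨1, one_pos, by simp [he]⟩
  · obtain ⟨s₀, hs₀, hmin⟩ := Set.exists_min_image T.elements ρ T.finite hne
    refine ⟨ρ s₀, (hρ s₀ hs₀).1, fun s hs g p hg => ?_⟩
    obtain ⟨z, hz, hzρ⟩ := (hρ s hs).2 g p hg
    exact ⟨z, hz, (hmin s hs).trans hzρ⟩

/-- A segment in `closure Ω` has a long part in one element. -/
theorem exists_long_subsegment (T : Triangulation Ω) {p g : Plane} {L : ℝ} (hL : 0 ≤ L)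
    (hmem : ∀ x ∈ Set.Icc 0 L, p + x • g ∈ closure Ω) :
    ∃ s ∈ T.elements, ∃ x, 0 ≤ x ∧ x + L / T.elements.ncard ≤ L ∧
      p + x • g ∈ convexHull ℝ s ∧ p + (x + L / T.elements.ncard) • g ∈ convexHull ℝ s := by
  set M := T.elements.ncard with hM
  obtain ⟨s₀, hs₀, -⟩ := T.exists_mem_of_mem_closure (hmem 0 ⟨le_rfl, hL⟩)
  have hM0 : 0 < M := (Set.ncard_pos T.finite).2 ⟨s₀, hs₀⟩
  have hMR : (0 : ℝ) < M := by exact_mod_cast hM0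
  -- Pigeonhole: `M + 1` equally spaced points lie in `M` elements, so two of them share one.
  have hpt : ∀ k ∈ Finset.range (M + 1), ∃ s ∈ T.elements,
      p + ((k : ℝ) * (L / M)) • g ∈ convexHull ℝ s := by
    intro k hk
    refine T.exists_mem_of_mem_closure (hmem _ ⟨by positivity, ?_⟩)
    have hk' : (k : ℝ) ≤ M := by exact_mod_cast Finset.mem_range_succ_iff.1 hk
    calc (k : ℝ) * (L / M) ≤ M * (L / M) := by gcongr
      _ = L := by field_simp
  choose! e he hke using hpt
  obtain ⟨k, hk, l, hl, hkl, hekl⟩ := Finset.exists_ne_map_eq_of_card_lt_of_maps_to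
    (s := Finset.range (M + 1)) (t := T.finite.toFinset) (f := e)
    (by rw [← Set.ncard_eq_toFinset_card _ T.finite, Finset.card_range]; exact Nat.lt_succ_self _)
    (fun k hk => by simpa using he k hk)
  wlog hlt : k < l generalizing k l
  · exact this l hl k hk hkl.symm hekl.symm (lt_of_le_of_ne (not_lt.1 hlt) hkl.symm)
  have hl' : (l : ℝ) ≤ M := by exact_mod_cast Finset.mem_range_succ_iff.1 hl
  have hkl' : (k : ℝ) + 1 ≤ l := by exact_mod_cast hlt
  have h1 := hke k hk
  have h2 := hke l hl
  rw [← hekl] at h2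
  refine ⟨e k, he k hk, k * (L / M), by positivity, ?_, h1, ?_⟩
  · calc (k : ℝ) * (L / M) + L / M = (k + 1) * (L / M) := by ring
      _ ≤ M * (L / M) := by gcongr; linarith
      _ = L := by field_simp
  · have hd : (0 : ℝ) < l - k := by linarith
    have := convex_convexHull ℝ (e k) h1 h2 (a := 1 - 1 / (l - k)) (b := 1 / (l - k))
      (by rw [sub_nonneg, div_le_one hd]; linarith) (by positivity) (by ring)
    convert! this using 1
    have e1 : (k : ℝ) * (L / M) + L / M = (1 - 1 / (l - k)) * (k * (L / M)) +
        1 / (l - k) * (l * (L / M)) := by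
      field_simp
      ring
    rw [e1]
    module

end Triangulation

namespace Band

variable {Ω : Set Plane} {T : Triangulation Ω} {N : ℕ} {B : Band T N}
  {U : Plane → ℝ} {G : Set Plane → Plane} {g : Plane} {t : Fin (N + 2) → ℝ}

/-- On a sufficiently long band the tangential derivative of a good approximation varies as much
as that of `u`. -/
theorem lt_slopeVariation (hG : T.IsElementGradient U G)
    (hU : ContinuousOn U (closure Ω)) (hΩ : Bornology.IsBounded Ω)
    (hreg : interior (closure Ω) = Ω) (hg : ‖g‖ = 1)
    (ht : StrictMono t) (h0 : t 0 = 0) (hL : t (Fin.last _) = B.length)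
    (hP : ∀ i, B.P i = B.P 0 + t i • g) (T₀ : Triangulation Ω) {ρ : ℝ} (hρ : 0 < ρ)
    (hfar : ∀ s ∈ T₀.elements, ∀ g p : Plane, ‖g‖ = 1 → ∃ z ∈ s, ρ ≤ |cross g (z - p)|)
    (hlong : 48 * Metric.diam (closure Ω) ^ 2 * ρ⁻¹ *
      h1Seminorm Ω (fun x => quadratic x - U x) ^ 2 < (B.length / (3 * T₀.elements.ncard)) ^ 5) :
    B.length / (3 * T₀.elements.ncard) / 2 < B.slopeVariation G g := by
  have hL0 : 0 ≤ B.length := by rw [← hL, ← h0]; exact ht.monotone (Fin.zero_le _)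
  obtain ⟨s, hs, x, hx, hxL, hxs, hys⟩ := T₀.exists_long_subsegment hL0
    fun x hx => mem_closure_of_mem_Icc ht h0 hL hP hx
  -- The piece inside one triangle of `T₀` has length `L / M`, and `pow_five_le` consumes a segment
  -- of length `3δ`.
  set δ := B.length / (3 * T₀.elements.ncard) with hδ
  have hδ0 : 0 ≤ δ := by positivity
  have h3 : B.length / T₀.elements.ncard = 3 * δ := by rw [hδ]; ring
  rw [h3] at hxL hys
  by_contra! hS
  obtain ⟨z, hz, hzρ⟩ := hfar s hs g (B.P 0 + x • g) hg
  refine hlong.not_ge ?_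
  refine (hG.pow_five_le hU hΩ hreg (convex_convexHull ℝ s) (T₀.element_subset hs) hδ0 hxs
    (by rwa [add_assoc, ← add_smul]) (subset_convexHull ℝ s hz)
    (abs_pos.1 (hρ.trans_le hzρ)) rfl ?_).trans ?_
  · intro w hw
    have := sq_le_abs_second_difference hG hU hg ht h0 hL hP (x := x + w) (δ := δ)
      (by linarith [hw.1]) hδ0 (by linarith [hw.2]) hS rfl
    have hre : ∀ v : ℝ, B.P 0 + x • g + v • g = B.P 0 + (x + v) • g := fun v => by module
    simp only [hre]
    rwa [← add_assoc, ← add_assoc]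
  · rw [abs_inv]
    gcongr

end Band

/-! ### Angles -/

/-- For `sin θ ≥ 1/2` this is Cauchy-Schwarz. Otherwise `θ ≥ π/3` forces an obtuse angle; then
removing from `w` its negative multiple of `r` only increases the `n`-component and leaves a vector
of norm `sin θ * ‖w‖`. -/
theorem inner_le_two_sin_mul_norm {r w n : Plane} (hn : ‖n‖ = 1) (hr : 0 < inner ℝ r n)
    (hw : 0 < inner ℝ w n) (hθ : Real.pi / 3 ≤ InnerProductGeometry.angle r w) :
    inner ℝ w n ≤ 2 * Real.sin (InnerProductGeometry.angle r w) * ‖w‖ := by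
  set θ := InnerProductGeometry.angle r w with hθd
  have hsin0 : 0 ≤ Real.sin θ := InnerProductGeometry.sin_angle_nonneg _ _
  have hr0 : r ≠ 0 := by rintro rfl; simp at hr
  have hrn : 0 < ‖r‖ := norm_pos_iff.2 hr0
  rcases le_total (1 / 2) (Real.sin θ) with h | h
  · have h1 := real_inner_le_norm w n
    rw [hn, mul_one] at h1
    nlinarith [norm_nonneg w]
  · have hcos : Real.cos θ ≤ 0 := by
      by_contra! hc
      have h1 : Real.cos θ ≤ 1 / 2 := by
        rw [← Real.cos_pi_div_three]
        exact Real.cos_le_cos_of_nonneg_of_le_pi (by positivity)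
          (InnerProductGeometry.angle_le_pi _ _) hθ
      nlinarith [Real.sin_sq_add_cos_sq θ]
    have hin : inner ℝ r w ≤ 0 := by
      rw [← InnerProductGeometry.cos_angle_mul_norm_mul_norm]
      exact mul_nonpos_of_nonpos_of_nonneg hcos (by positivity)
    set c := inner ℝ r w / ‖r‖ ^ 2 with hc
    have hcn : c ≤ 0 := div_nonpos_of_nonpos_of_nonneg hin (by positivity)
    have hnorm : ‖w - c • r‖ = Real.sin θ * ‖w‖ := by
      have e1 : ‖w - c • r‖ ^ 2 = (Real.sin θ * ‖w‖) ^ 2 := by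
        have hcw := InnerProductGeometry.cos_angle_mul_norm_mul_norm r w
        rw [norm_sub_sq_real, real_inner_smul_right, norm_smul, real_inner_comm, mul_pow,
          Real.norm_eq_abs, sq_abs, hc, ← hcw, mul_pow, Real.sin_sq]
        field_simp
        ring
      exact (pow_left_inj₀ (norm_nonneg _) (by positivity) two_ne_zero).1 e1
    have h2 := real_inner_le_norm (w - c • r) n
    rw [hn, mul_one, hnorm, inner_sub_left, real_inner_smul_left] at h2
    nlinarith [norm_nonneg w, mul_nonneg hsin0 (norm_nonneg w)]

theorem abs_cross_le_two_sin_mul_norm {r w g : Plane} (hg : ‖g‖ = 1)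
    (h : 0 < cross g r * cross g w) (hθ : Real.pi / 3 ≤ InnerProductGeometry.angle r w) :
    |cross g w| ≤ 2 * Real.sin (InnerProductGeometry.angle r w) * ‖w‖ := by
  set n : Plane := !₂[-g 1, g 0] with hn
  have hn1 : ‖n‖ = 1 := by
    have : ‖n‖ ^ 2 = ‖g‖ ^ 2 := by rw [norm_sq_eq, norm_sq_eq]; simp [hn]; ring
    rw [hg] at this
    exact (pow_left_inj₀ (norm_nonneg _) zero_le_one two_ne_zero).1 (by simpa using this)
  have hin : ∀ v, inner ℝ v n = cross g v := by
    intro v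
    rw [inner_eq]; simp [hn, cross]; ring
  rcases lt_or_gt_of_ne (left_ne_zero_of_mul h.ne') with h1 | h1
  · have h2 : cross g w < 0 := by nlinarith
    rw [abs_of_neg h2]
    have := inner_le_two_sin_mul_norm (n := -n) (r := r) (w := w) (by rwa [norm_neg])
      (by rw [inner_neg_right, hin]; linarith) (by rw [inner_neg_right, hin]; linarith) hθ
    rwa [inner_neg_right, hin] at this
  · have h2 : 0 < cross g w := by nlinarith
    rw [abs_of_pos h2]
    have := inner_le_two_sin_mul_norm (n := n) (r := r) (w := w) hn1
      (by rwa [hin]) (by rwa [hin]) hθ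
    rwa [hin] at this

/-- In the plane, the cosine of the angle between `g` and a normal of `w` is, up to sign, the sine
of the angle between `g` and `w`. -/
theorem abs_inner_mul_norm_of_inner_eq_zero {v w : Plane} (g : Plane)
    (h : inner ℝ v w = 0) : |inner ℝ v g| * ‖w‖ = ‖v‖ * |cross g w| := by
  refine (pow_left_inj₀ (by positivity) (by positivity) two_ne_zero).1 ?_
  rw [mul_pow, mul_pow, sq_abs, sq_abs, norm_sq_eq, norm_sq_eq]
  rw [inner_eq] at h ⊢
  rw [cross]
  linear_combination ((g 0 ^ 2 - g 1 ^ 2) * (v 0 * w 0 - v 1 * w 1) +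
    2 * g 0 * g 1 * (v 1 * w 0 + v 0 * w 1)) * h

theorem pi_div_three_le_maxAngle {a b c : Plane} (h : b ≠ a) :
    Real.pi / 3 ≤ maxAngle a b c := by
  have h1 := EuclideanGeometry.angle_add_angle_add_angle_eq_pi c h
  have h2 : EuclideanGeometry.angle b a c ≤ maxAngle a b c := le_max_left _ _
  have h3 : EuclideanGeometry.angle a b c ≤ maxAngle a b c :=
    (le_max_left _ _).trans (le_max_right _ _)
  have h4 : EuclideanGeometry.angle a c b ≤ maxAngle a b c :=
    (le_max_right _ _).trans (le_max_right _ _)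
  rw [EuclideanGeometry.angle_comm b c a, EuclideanGeometry.angle_comm c a b] at h1
  linarith

namespace Triangulation

variable {Ω : Set Plane} {T : Triangulation Ω} {U : Plane → ℝ} {G : Set Plane → Plane}

/-! ### Element-wise energy -/

theorem volume_interior {s : Set Plane} :
    (volume (interior (convexHull ℝ s))).toReal = area s := by
  rw [area, measure_congr (interior_ae_eq_of_null_frontier
    ((convex_convexHull ℝ s).addHaar_frontier volume))]

theorem sum_setIntegral_le (T : Triangulation Ω) {ι : Type*} [Fintype ι] {e : ι → Set Plane}
    (he : ∀ i, e i ∈ T.elements) (hinj : Function.Injective e) {φ : Plane → ℝ} (hφ : ∀ x, 0 ≤ φ x)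
    (hint : IntegrableOn φ (closure Ω)) :
    ∑ i, ∫ x in interior (convexHull ℝ (e i)), φ x ≤ ∫ x in closure Ω, φ x := by
  have hsub : ∀ i, interior (convexHull ℝ (e i)) ⊆ closure Ω := fun i =>
    _root_.interior_subset.trans (T.element_subset (he i))
  rw [← integral_iUnion_fintype (fun i => isOpen_interior.measurableSet)
    (fun i j hij => T.disjoint_interior (he i) (he j) (hinj.ne hij))
    (fun i => hint.mono_set (hsub i))]
  exact setIntegral_mono_set hint (ae_of_all _ hφ) (Set.iUnion_subset hsub).eventuallyLE

/-- The gradient error `2x - G s` moves by at most `2h` across an element, so its value at a point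
is controlled by its mean square. The area is kept as an integral of `1` so that both terms can be
summed over disjoint interiors alike. -/
theorem IsElementGradient.area_mul_sq_le (hG : T.IsElementGradient U G)
    (hΩ : Bornology.IsBounded Ω) {s : Set Plane} (hs : s ∈ T.elements) {p : Plane}
    (hp : p ∈ convexHull ℝ s) :
    area s * ‖(2 : ℝ) • p - G s‖ ^ 2 ≤
      2 * (∫ x in interior (convexHull ℝ s), ‖gradient (fun x => quadratic x - U x) x‖ ^ 2) +
        8 * T.meshSize ^ 2 * ∫ _ in interior (convexHull ℝ s), (1 : ℝ) := by
  have hfin : volume (interior (convexHull ℝ s)) ≠ ⊤ :=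
    ((measure_mono _root_.interior_subset).trans_lt
      (T.isCompact_element hs).measure_lt_top).ne
  have hsub : interior (convexHull ℝ s) ⊆ closure Ω :=
    _root_.interior_subset.trans (T.element_subset hs)
  have hi := (hG.integrableOn hΩ).mono_set hsub
  have hc : IntegrableOn (fun _ : Plane => (1 : ℝ)) (interior (convexHull ℝ s)) :=
    integrableOn_const hfin
  rw [← integral_const_mul, ← integral_const_mul, ← integral_add (hi.const_mul _)
    (hc.const_mul _), ← volume_interior]
  have h1 : (volume (interior (convexHull ℝ s))).toReal * ‖(2 : ℝ) • p - G s‖ ^ 2 =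
      ∫ x in interior (convexHull ℝ s), ‖(2 : ℝ) • p - G s‖ ^ 2 := by
    rw [setIntegral_const, smul_eq_mul, Measure.real]
  rw [h1]
  refine setIntegral_mono_on (integrableOn_const hfin) ((hi.const_mul _).add (hc.const_mul _))
    isOpen_interior.measurableSet fun x hx => ?_
  rw [hG.gradient_eq hs hx]
  have hd := T.dist_le_meshSize hs hp (_root_.interior_subset hx)
  rw [dist_eq_norm] at hd
  have h2 : ‖(2 : ℝ) • p - G s‖ ≤ ‖(2 : ℝ) • x - G s‖ + 2 * T.meshSize := by
    have : (2 : ℝ) • p - G s = ((2 : ℝ) • x - G s) + (2 : ℝ) • (p - x) := by module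
    rw [this]
    refine (norm_add_le _ _).trans ?_
    rw [norm_smul, Real.norm_of_nonneg zero_le_two]
    linarith
  have h3 := pow_le_pow_left₀ (norm_nonneg _) h2 2
  nlinarith [sq_nonneg (‖(2 : ℝ) • x - G s‖ - 2 * T.meshSize)]

theorem IsElementGradient.sum_area_mul_sq_le (hG : T.IsElementGradient U G)
    (hΩ : Bornology.IsBounded Ω) (hreg : interior (closure Ω) = Ω)
    {ι : Type*} [Fintype ι] {e : ι → Set Plane}
    (he : ∀ i, e i ∈ T.elements) (hinj : Function.Injective e) {p : ι → Plane}
    (hp : ∀ i, p i ∈ e i) :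
    ∑ i, area (e i) * ‖(2 : ℝ) • p i - G (e i)‖ ^ 2 ≤
      2 * h1Seminorm Ω (fun x => quadratic x - U x) ^ 2 +
        8 * T.meshSize ^ 2 * (volume (closure Ω)).toReal := by
  refine (Finset.sum_le_sum fun i _ => hG.area_mul_sq_le hΩ (he i)
    (subset_convexHull ℝ _ (hp i))).trans ?_
  rw [Finset.sum_add_distrib, ← Finset.mul_sum, ← Finset.mul_sum]
  have hfin : volume (closure Ω) ≠ ⊤ :=
    (Metric.isCompact_of_isClosed_isBounded isClosed_closure hΩ.closure).measure_ne_top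
  have h1 := T.sum_setIntegral_le he hinj (fun x => by positivity) (hG.integrableOn hΩ)
  have h2 := T.sum_setIntegral_le he hinj (φ := fun _ => 1) (fun x => zero_le_one)
    (integrableOn_const hfin)
  rw [setIntegral_congr_set (T.closure_ae_eq hreg)] at h1
  rw [setIntegral_const, smul_eq_mul, mul_one, Measure.real] at h2
  rw [h1Seminorm, Real.sq_sqrt (integral_nonneg fun x => by positivity)]
  gcongr

/-- `U` is single-valued on a common edge, so gradient jumps have no component along it. -/
theorem IsElementGradient.inner_sub_eq_zero (hG : T.IsElementGradient U G) {s t : Set Plane}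
    (hs : s ∈ T.elements) (ht : t ∈ T.elements) {x y : Plane} (hxs : x ∈ s) (hys : y ∈ s)
    (hxt : x ∈ t) (hyt : y ∈ t) : inner ℝ (G s - G t) (y - x) = 0 := by
  rw [inner_sub_left, ← hG s hs x (subset_convexHull ℝ _ hxs) y (subset_convexHull ℝ _ hys),
    ← hG t ht x (subset_convexHull ℝ _ hxt) y (subset_convexHull ℝ _ hyt), sub_self]

end Triangulation

/-! ### Geometry of a band and its gradient jumps -/

namespace Band

variable {Ω : Set Plane} {T : Triangulation Ω} {N : ℕ} {B : Band T N}
  {U : Plane → ℝ} {G : Set Plane → Plane} {g : Plane} {t : Fin (N + 2) → ℝ}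

theorem cross_sub_P_eq (hP : ∀ i, B.P i = B.P 0 + t i • g) (x : Plane) (k : Fin (N + 2)) :
    cross g (x - B.P k) = cross g (x - B.P 0) := by
  rw [hP k]; simp [cross]; ring

theorem cross_Q_ne_zero (hP : ∀ i, B.P i = B.P 0 + t i • g) (i : Fin (N + 1)) :
    cross g (B.Q i - B.P 0) ≠ 0 := by
  intro h
  have hpos := T.area_pos (B.mem_K i)
  rw [area_eq] at hpos
  have h1 : cross (B.Q i - B.P i.castSucc) (B.P i.succ - B.P i.castSucc) =
      -(t i.succ - t i.castSucc) * cross g (B.Q i - B.P i.castSucc) := by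
    rw [hP i.succ, hP i.castSucc]; simp [cross]; ring
  rw [h1, cross_sub_P_eq hP, h] at hpos
  simp at hpos

theorem cross_eq_zero_of_mem_affineSpan (hP : ∀ i, B.P i = B.P 0 + t i • g) {x : Plane}
    (hx : x ∈ affineSpan ℝ (Set.range B.P)) : cross g (x - B.P 0) = 0 := by
  have hle : affineSpan ℝ (Set.range B.P) ≤
      AffineSubspace.mk' (B.P 0) (Submodule.span ℝ {g}) := by
    rw [affineSpan_le]
    rintro _ ⟨i, rfl⟩
    rw [SetLike.mem_coe, AffineSubspace.mem_mk', hP i, vsub_eq_sub, add_sub_cancel_left]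
    exact Submodule.smul_mem _ _ (Submodule.mem_span_singleton_self g)
  have := hle hx
  rw [AffineSubspace.mem_mk', vsub_eq_sub, Submodule.mem_span_singleton] at this
  obtain ⟨c, hc⟩ := this
  rw [← hc]
  simp [cross]; ring

theorem cross_mul_cross_pos (hP : ∀ i, B.P i = B.P 0 + t i • g) (i j : Fin (N + 1)) :
    0 < cross g (B.Q i - B.P 0) * cross g (B.Q j - B.P 0) := by
  obtain ⟨⟨p₁, hp₁, p₂, hp₂, hray⟩, -, -⟩ := B.oneSide i j
  have c1 := cross_eq_zero_of_mem_affineSpan hP hp₁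
  have c2 := cross_eq_zero_of_mem_affineSpan hP hp₂
  have n1 := cross_Q_ne_zero hP i
  have n2 := cross_Q_ne_zero hP j
  have e1 : cross g (B.Q i - p₁) = cross g (B.Q i - B.P 0) := by
    have : cross g (B.Q i - p₁) = cross g (B.Q i - B.P 0) - cross g (p₁ - B.P 0) := by
      simp [cross]; ring
    rw [this, c1, sub_zero]
  have e2 : cross g (B.Q j - p₂) = cross g (B.Q j - B.P 0) := by
    have : cross g (B.Q j - p₂) = cross g (B.Q j - B.P 0) - cross g (p₂ - B.P 0) := by
      simp [cross]; ring
    rw [this, c2, sub_zero]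
  rw [vsub_eq_sub, vsub_eq_sub] at hray
  rcases hray with h | h | ⟨r₁, r₂, h₁, h₂, h⟩
  · rw [h] at e1; exact absurd (by rw [← e1]; simp [cross]) n1
  · rw [h] at e2; exact absurd (by rw [← e2]; simp [cross]) n2
  · have hc : r₁ * cross g (B.Q i - p₁) = r₂ * cross g (B.Q j - p₂) := by
      have := congrArg (cross g) h
      have hs : ∀ (r : ℝ) (v : Plane), cross g (r • v) = r * cross g v := by
        intro r v; simp [cross]; ring
      rwa [hs, hs] at this
    rw [e1, e2] at hc
    have : cross g (B.Q i - B.P 0) = r₂ / r₁ * cross g (B.Q j - B.P 0) := by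
      field_simp; linarith
    rw [this, mul_assoc]
    exact mul_pos (by positivity) (mul_self_pos.2 n2)

theorem P_injective (B : Band T N) : Function.Injective B.P := by
  obtain ⟨g, hg, t, ht, -, -, hP⟩ := B.exists_param
  intro i j h
  rw [hP i, hP j, add_right_inj] at h
  have hg0 : g ≠ 0 := by rintro rfl; simp at hg
  exact ht.injective (smul_left_injective ℝ hg0 h)

theorem P_ne_Q (B : Band T N) (i : Fin (N + 2)) (j : Fin (N + 1)) : B.P i ≠ B.Q j := by
  obtain ⟨g, hg, t, ht, -, -, hP⟩ := B.exists_param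
  intro h
  refine cross_Q_ne_zero hP j ?_
  rw [← h, hP i]
  simp [cross]; ring

theorem K_injective (B : Band T N) : Function.Injective B.K := by
  -- The left base vertex of `K i` may also be the right one of its predecessor, so it yields only
  -- an inequality of indices; symmetry gives equality.
  have key : ∀ i j, B.K i = B.K j → j ≤ i := by
    intro i j h
    have h1 : B.P i.castSucc ∈ B.K j := by rw [← h]; simp [K]
    rcases h1 with h1 | h1 | h1
    · exact (Fin.castSucc_injective _ (B.P_injective h1)).ge
    · exact absurd h1 (B.P_ne_Q _ _)
    · have := B.P_injective h1
      rw [Fin.le_def]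
      have := congrArg Fin.val this
      simp at this
      omega
  exact fun i j h => le_antisymm (key j i h.symm) (key i j h)

theorem Ktilde_injective (B : Band T N) : Function.Injective B.Ktilde := by
  intro i j h
  have h1 : B.P i.succ.castSucc ∈ B.Ktilde j := by rw [← h]; simp [Ktilde]
  rcases h1 with h1 | h1 | h1
  · exact absurd h1 (B.P_ne_Q _ _)
  · exact Fin.succ_injective _ (Fin.castSucc_injective _ (B.P_injective h1))
  · exact absurd h1 (B.P_ne_Q _ _)

theorem alphaTilde_eq (B : Band T N) (i : Fin N) : B.alphaTilde i =
    InnerProductGeometry.angle (B.Q i.castSucc - B.P i.succ.castSucc)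
      (B.Q i.succ - B.P i.succ.castSucc) :=
  B.maxAngle_Ktilde i

theorem sin_alphaTilde_nonneg (B : Band T N) (i : Fin N) :
    0 ≤ Real.sin (Real.pi - B.alphaTilde i) := by
  rw [Real.sin_pi_sub, alphaTilde_eq]
  exact InnerProductGeometry.sin_angle_nonneg _ _

theorem pi_div_three_le_alphaTilde (B : Band T N) (i : Fin N) :
    Real.pi / 3 ≤ B.alphaTilde i :=
  pi_div_three_le_maxAngle (B.P_ne_Q _ _)

/-- The jump of the gradient across the two inner edges of `Ktilde i` controls the jump of the
tangential derivative. -/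
theorem abs_slope_sub_le (hG : T.IsElementGradient U G) (hg : ‖g‖ = 1)
    (hP : ∀ i, B.P i = B.P 0 + t i • g) (i : Fin N) :
    |inner ℝ (G (B.K i.succ)) g - inner ℝ (G (B.K i.castSucc)) g| ≤
      2 * Real.sin (Real.pi - B.alphaTilde i) * (‖G (B.K i.succ) - G (B.Ktilde i)‖ +
        ‖G (B.Ktilde i) - G (B.K i.castSucc)‖) := by
  set p := B.P i.succ.castSucc with hp
  set w := B.Q i.succ - p with hw
  set r := B.Q i.castSucc - p with hr
  have hθ := B.pi_div_three_le_alphaTilde i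
  rw [Real.sin_pi_sub]
  rw [alphaTilde_eq] at hθ ⊢
  have hpos : 0 < cross g r * cross g w := by
    rw [hr, hw, hp, cross_sub_P_eq hP (B.Q i.castSucc), cross_sub_P_eq hP (B.Q i.succ)]
    exact cross_mul_cross_pos hP _ _
  have hpos' : 0 < cross g w * cross g r := by rwa [mul_comm]
  have b1 := abs_cross_le_two_sin_mul_norm hg hpos hθ
  have b2 := abs_cross_le_two_sin_mul_norm hg hpos'
    (by rw [InnerProductGeometry.angle_comm]; exact hθ)
  rw [InnerProductGeometry.angle_comm] at b2
  have hw0 : 0 < ‖w‖ := norm_pos_iff.2 (sub_ne_zero.2 (B.P_ne_Q _ _).symm)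
  have hr0 : 0 < ‖r‖ := norm_pos_iff.2 (sub_ne_zero.2 (B.P_ne_Q _ _).symm)
  have hpc : p = B.P i.castSucc.succ := by rw [hp, Fin.succ_castSucc]
  have o1 : inner ℝ (G (B.K i.succ) - G (B.Ktilde i)) w = 0 :=
    hG.inner_sub_eq_zero (B.mem_K i.succ) (B.mem_Ktilde i) (by simp [hp]) (by simp)
      (by simp [hp]) (by simp)
  have o2 : inner ℝ (G (B.Ktilde i) - G (B.K i.castSucc)) r = 0 :=
    hG.inner_sub_eq_zero (B.mem_Ktilde i) (B.mem_K i.castSucc) (by simp [hp]) (by simp)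
      (by simp [hpc]) (by simp)
  -- If the edge `x` makes an angle of sine at most `σ` with the base line, a jump normal to `x` has
  -- tangential part at most `σ` times its norm.
  have aux : ∀ {v x : Plane} {σ : ℝ}, inner ℝ v x = 0 → 0 < ‖x‖ → |cross g x| ≤ σ * ‖x‖ →
      |inner ℝ v g| ≤ σ * ‖v‖ := by
    intro v x σ ho hx hb
    have := abs_inner_mul_norm_of_inner_eq_zero g ho
    refine le_of_mul_le_mul_right ?_ hx
    rw [this]
    nlinarith [mul_le_mul_of_nonneg_left hb (norm_nonneg v)]
  have a1 := aux o1 hw0 b1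
  have a2 := aux o2 hr0 b2
  have hsplit : inner ℝ (G (B.K i.succ)) g - inner ℝ (G (B.K i.castSucc)) g =
      inner ℝ (G (B.K i.succ) - G (B.Ktilde i)) g +
        inner ℝ (G (B.Ktilde i) - G (B.K i.castSucc)) g := by
    rw [inner_sub_left, inner_sub_left]; ring
  rw [hsplit, mul_add]
  exact (abs_add_le _ _).trans (add_le_add a1 a2)

/-- Each jump is a difference of gradient errors at a vertex common to all three elements. `K̃`
enters both jumps, so expanding the square gives weights `4c + 8 + 4c = 8(c + 1)`. -/
theorem sum_area_mul_jump_sq_le (hG : T.IsElementGradient U G)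
    (hΩ : Bornology.IsBounded Ω) (hreg : interior (closure Ω) = Ω) {c : ℝ} (hc : 0 ≤ c)
    (hcomp : ∀ i : Fin N, area (B.Ktilde i) ≤ c * area (B.K i.succ) ∧
      area (B.Ktilde i) ≤ c * area (B.K i.castSucc)) :
    ∑ i, area (B.Ktilde i) * (‖G (B.K i.succ) - G (B.Ktilde i)‖ +
        ‖G (B.Ktilde i) - G (B.K i.castSucc)‖) ^ 2 ≤
      8 * (c + 1) * (2 * h1Seminorm Ω (fun x => quadratic x - U x) ^ 2 +
        8 * T.meshSize ^ 2 * (volume (closure Ω)).toReal) := by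
  have s1 := hG.sum_area_mul_sq_le hΩ hreg (e := fun i : Fin N => B.K i.succ)
    (p := fun i => B.P i.succ.castSucc) (fun i => B.mem_K i.succ)
    (B.K_injective.comp (Fin.succ_injective _)) (fun i => by simp [K])
  have s2 := hG.sum_area_mul_sq_le hΩ hreg (e := B.Ktilde)
    (p := fun i => B.P i.succ.castSucc) B.mem_Ktilde
    B.Ktilde_injective (fun i => by simp [Ktilde])
  have s3 := hG.sum_area_mul_sq_le hΩ hreg (e := fun i : Fin N => B.K i.castSucc)
    (p := fun i => B.P i.succ.castSucc) (fun i => B.mem_K i.castSucc)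
    (B.K_injective.comp (Fin.castSucc_injective _)) (fun i => by simp [K])
  set W := 2 * h1Seminorm Ω (fun x => quadratic x - U x) ^ 2 +
        8 * T.meshSize ^ 2 * (volume (closure Ω)).toReal
  have hpt : ∀ i : Fin N, area (B.Ktilde i) * (‖G (B.K i.succ) - G (B.Ktilde i)‖ +
        ‖G (B.Ktilde i) - G (B.K i.castSucc)‖) ^ 2 ≤
      4 * c * (area (B.K i.succ) * ‖(2 : ℝ) • B.P i.succ.castSucc - G (B.K i.succ)‖ ^ 2) +
      8 * (area (B.Ktilde i) * ‖(2 : ℝ) • B.P i.succ.castSucc - G (B.Ktilde i)‖ ^ 2) +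
      4 * c * (area (B.K i.castSucc) *
        ‖(2 : ℝ) • B.P i.succ.castSucc - G (B.K i.castSucc)‖ ^ 2) := by
    intro i
    set q := (2 : ℝ) • B.P i.succ.castSucc
    have n1 : ‖G (B.K i.succ) - G (B.Ktilde i)‖ ≤
        ‖q - G (B.K i.succ)‖ + ‖q - G (B.Ktilde i)‖ := by
      have : G (B.K i.succ) - G (B.Ktilde i) =
        (q - G (B.Ktilde i)) - (q - G (B.K i.succ)) := by abel
      rw [this, add_comm]
      exact norm_sub_le _ _
    have n2 : ‖G (B.Ktilde i) - G (B.K i.castSucc)‖ ≤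
        ‖q - G (B.Ktilde i)‖ + ‖q - G (B.K i.castSucc)‖ := by
      have : G (B.Ktilde i) - G (B.K i.castSucc) =
        (q - G (B.K i.castSucc)) - (q - G (B.Ktilde i)) := by abel
      rw [this, add_comm]
      exact norm_sub_le _ _
    have hA : 0 ≤ area (B.Ktilde i) := (T.area_pos (B.mem_Ktilde i)).le
    have h4 := Triangulation.sum_four_sq ‖q - G (B.K i.succ)‖ ‖q - G (B.Ktilde i)‖
      ‖q - G (B.Ktilde i)‖ ‖q - G (B.K i.castSucc)‖
    have h5 := (pow_le_pow_left₀ (by positivity) (add_le_add n1 n2) 2).trans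
      (le_of_eq (by ring : _ = (‖q - G (B.K i.succ)‖ + ‖q - G (B.Ktilde i)‖ +
        ‖q - G (B.Ktilde i)‖ + ‖q - G (B.K i.castSucc)‖) ^ 2))
    have h6 := mul_le_mul_of_nonneg_left (h5.trans h4) hA
    have h7 := mul_le_mul_of_nonneg_right (hcomp i).1 (sq_nonneg ‖q - G (B.K i.succ)‖)
    have h8 := mul_le_mul_of_nonneg_right (hcomp i).2 (sq_nonneg ‖q - G (B.K i.castSucc)‖)
    linarith
  refine (Finset.sum_le_sum fun i _ => hpt i).trans ?_
  rw [Finset.sum_add_distrib, Finset.sum_add_distrib, ← Finset.mul_sum, ← Finset.mul_sum,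
    ← Finset.mul_sum]
  have t1 := mul_le_mul_of_nonneg_left s1 (by positivity : 0 ≤ 4 * c)
  have t3 := mul_le_mul_of_nonneg_left s3 (by positivity : 0 ≤ 4 * c)
  linarith

/-- The infima cancel the sine and bring in the area weight of each jump; Cauchy-Schwarz over the
`N` jumps then costs `√N`. -/
theorem iInf_mul_slopeVariation_le (hG : T.IsElementGradient U G)
    (hΩ : Bornology.IsBounded Ω) (hreg : interior (closure Ω) = Ω) (hg : ‖g‖ = 1)
    (hP : ∀ i, B.P i = B.P 0 + t i • g) {c : ℝ} (hc : 0 ≤ c)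
    (hcomp : ∀ i : Fin N, area (B.Ktilde i) ≤ c * area (B.K i.succ) ∧
      area (B.Ktilde i) ≤ c * area (B.K i.castSucc)) :
    (⨅ i : Fin N, 1 / Real.sin (Real.pi - B.alphaTilde i)) *
      (⨅ i : Fin N, √(area (B.Ktilde i))) * B.slopeVariation G g ≤
      2 * (√N * √(8 * (c + 1) * (2 * h1Seminorm Ω (fun x => quadratic x - U x) ^ 2 +
        8 * T.meshSize ^ 2 * (volume (closure Ω)).toReal))) := by
  set m₁ := ⨅ i : Fin N, 1 / Real.sin (Real.pi - B.alphaTilde i) with hm₁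
  set m₂ := ⨅ i : Fin N, √(area (B.Ktilde i)) with hm₂
  have p1 : 0 ≤ m₁ := Real.iInf_nonneg fun i => one_div_nonneg.2 (B.sin_alphaTilde_nonneg i)
  have p2 : 0 ≤ m₂ := Real.iInf_nonneg fun i => Real.sqrt_nonneg _
  set X : Fin N → ℝ := fun i => ‖G (B.K i.succ) - G (B.Ktilde i)‖ +
        ‖G (B.Ktilde i) - G (B.K i.castSucc)‖ with hX
  have hX0 : ∀ i, 0 ≤ X i := fun i => by positivity
  have hle : ∀ i : Fin N, m₁ * m₂ *
      |inner ℝ (G (B.K i.succ)) g - inner ℝ (G (B.K i.castSucc)) g| ≤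
      2 * (1 * (√(area (B.Ktilde i)) * X i)) := by
    intro i
    have h1 : m₁ ≤ 1 / Real.sin (Real.pi - B.alphaTilde i) :=
      ciInf_le (Set.finite_range _).bddBelow i
    have h2 : m₂ ≤ √(area (B.Ktilde i)) := ciInf_le (Set.finite_range _).bddBelow i
    have h3 : m₁ * Real.sin (Real.pi - B.alphaTilde i) ≤ 1 := by
      -- A vanishing sine needs no geometric exclusion, since the product is then `0`.
      rcases (B.sin_alphaTilde_nonneg i).eq_or_lt with h | h
      · rw [← h, mul_zero]; exact zero_le_one
      · rwa [le_div_iff₀ h] at h1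
    have h4 := mul_le_mul_of_nonneg_left (abs_slope_sub_le hG hg hP i) (mul_nonneg p1 p2)
    refine h4.trans ?_
    calc m₁ * m₂ * (2 * Real.sin (Real.pi - B.alphaTilde i) * X i)
        = 2 * ((m₁ * Real.sin (Real.pi - B.alphaTilde i)) * (m₂ * X i)) := by ring
      _ ≤ 2 * (1 * (√(area (B.Ktilde i)) * X i)) := by
        have := hX0 i
        gcongr
  rw [slopeVariation, Finset.mul_sum]
  refine (Finset.sum_le_sum fun i _ => hle i).trans ?_
  rw [← Finset.mul_sum]
  refine mul_le_mul_of_nonneg_left ?_ zero_le_two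
  refine (Real.sum_mul_le_sqrt_mul_sqrt Finset.univ (fun _ => (1 : ℝ))
    (fun i => √(area (B.Ktilde i)) * X i)).trans ?_
  have e1 : ∑ i : Fin N, (1 : ℝ) ^ 2 = N := by simp
  rw [e1]
  refine mul_le_mul_of_nonneg_left (Real.sqrt_le_sqrt ?_) (Real.sqrt_nonneg _)
  refine le_trans (le_of_eq ?_) (sum_area_mul_jump_sq_le hG hΩ hreg hc hcomp)
  refine Finset.sum_congr rfl fun i _ => ?_
  have h : 0 ≤ area (B.Ktilde i) := (T.area_pos (B.mem_Ktilde i)).le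
  rw [mul_pow, Real.sq_sqrt h]

end Band

/-! ### The band estimate -/

namespace Band

variable {Ω : Set Plane} {T : Triangulation Ω} {N : ℕ} {B : Band T N}

/-- The band estimate with explicit constants; `T₀` is an auxiliary fixed triangulation. -/
theorem iInf_mul_length_le (hΩ : Bornology.IsBounded Ω) (hreg : interior (closure Ω) = Ω)
    {α : ℝ} (hα : α ∈ Set.Icc (0 : ℝ) 1) {U : Plane → ℝ} (hU : U ∈ T.feSpace)
    {C_u : ℝ} (hCu : 0 < C_u)
    (herr : h1Seminorm Ω (fun x => quadratic x - U x) ≤ C_u * T.meshSize ^ α)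
    (T₀ : Triangulation Ω) (hT₀ : 0 < T₀.elements.ncard) {ρ : ℝ} (hρ : 0 < ρ)
    (hfar : ∀ s ∈ T₀.elements, ∀ g p : Plane, ‖g‖ = 1 → ∃ z ∈ s, ρ ≤ |cross g (z - p)|)
    (hlen : 3 * T₀.elements.ncard * (48 * Metric.diam (closure Ω) ^ 2 * ρ⁻¹ + 1) *
      C_u ^ (2 / 5 : ℝ) * T.meshSize ^ (2 * α / 5) ≤ B.length)
    {c : ℝ} (hc : 0 ≤ c)
    (hcomp : ∀ i : Fin N, area (B.Ktilde i) ≤ c * area (B.K i.succ) ∧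
      area (B.Ktilde i) ≤ c * area (B.K i.castSucc)) :
    (⨅ i : Fin N, 1 / Real.sin (Real.pi - B.alphaTilde i)) *
      (⨅ i : Fin N, √(area (B.Ktilde i))) * B.length ≤
      √N * (12 * T₀.elements.ncard * √(8 * (c + 1) * (2 * C_u ^ 2 +
        8 * Metric.diam (closure Ω) ^ (2 - 2 * α) * (volume (closure Ω)).toReal)) *
        T.meshSize ^ α) := by
  obtain ⟨G, hG⟩ := T.exists_isElementGradient hU
  obtain ⟨g, hg, t, ht, h0, hL, hP⟩ := B.exists_param
  have hh : 0 < T.meshSize := T.meshSize_pos (B.mem_K 0)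
  have hhD : T.meshSize ≤ Metric.diam (closure Ω) := T.meshSize_le hΩ
  have hM : (0 : ℝ) < T₀.elements.ncard := by exact_mod_cast hT₀
  set E := h1Seminorm Ω (fun x => quadratic x - U x) with hE
  set M : ℝ := (T₀.elements.ncard : ℝ) with hMd
  set D := Metric.diam (closure Ω) with hD
  set V := (volume (closure Ω)).toReal with hV
  set h := T.meshSize with hhd
  set κ := 48 * D ^ 2 * ρ⁻¹ with hκ
  have hκ0 : 0 ≤ κ := by positivity
  have hV0 : 0 ≤ V := ENNReal.toReal_nonneg
  have hE0 : 0 ≤ E := Real.sqrt_nonneg _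
  have hE2 : E ^ 2 ≤ C_u ^ 2 * (h ^ α) ^ 2 := by
    rw [← mul_pow]; exact pow_le_pow_left₀ hE0 herr 2
  have hha : 0 < h ^ α := Real.rpow_pos_of_pos hh _
  have q1 : (C_u ^ (2 / 5 : ℝ)) ^ 5 = C_u ^ 2 := by
    rw [← Real.rpow_natCast, ← Real.rpow_mul hCu.le, ← Real.rpow_natCast]
    norm_num
  have q2 : (h ^ (2 * α / 5)) ^ 5 = (h ^ α) ^ 2 := by
    rw [← Real.rpow_natCast, ← Real.rpow_mul hh.le, ← Real.rpow_natCast, ← Real.rpow_mul hh.le]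
    congr 1
    push_cast
    ring
  -- The fifth power turns the threshold into `(κ + 1)^5 * C_u² * h^(2α)`. Using `κ + 1` avoids a
  -- fifth root of `κ` and keeps the inequality strict.
  have hlong : κ * E ^ 2 < (B.length / (3 * M)) ^ 5 := by
    have hle : (κ + 1) * C_u ^ (2 / 5 : ℝ) * h ^ (2 * α / 5) ≤ B.length / (3 * M) := by
      rw [le_div_iff₀ (by positivity)]
      linarith
    have hp := pow_le_pow_left₀ (by positivity) hle 5
    rw [mul_pow, mul_pow, q1, q2] at hp
    refine lt_of_lt_of_le ?_ hp
    have hk : κ < (κ + 1) ^ 5 :=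
      (lt_add_one κ).trans_le (le_self_pow₀ (by linarith) (by norm_num))
    calc κ * E ^ 2 ≤ κ * (C_u ^ 2 * (h ^ α) ^ 2) := by gcongr
      _ < (κ + 1) ^ 5 * (C_u ^ 2 * (h ^ α) ^ 2) := by gcongr
      _ = _ := by ring
  have hS := lt_slopeVariation hG hU.1 hΩ hreg hg ht h0 hL hP T₀ hρ hfar hlong
  have hmain := iInf_mul_slopeVariation_le hG hΩ hreg hg hP hc hcomp
  set m := (⨅ i : Fin N, 1 / Real.sin (Real.pi - B.alphaTilde i)) *
      (⨅ i : Fin N, √(area (B.Ktilde i))) with hm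
  have hm0 : 0 ≤ m := mul_nonneg
    (Real.iInf_nonneg fun i => one_div_nonneg.2 (B.sin_alphaTilde_nonneg i))
    (Real.iInf_nonneg fun i => Real.sqrt_nonneg _)
  -- As `α ≤ 1` and `h ≤ D`, the `h²` produced by the variation of `∇u` on an element is absorbed
  -- into the error bound.
  have hh2 : h ^ 2 ≤ D ^ (2 - 2 * α) * (h ^ α) ^ 2 := by
    have e : h ^ 2 = h ^ (2 - 2 * α) * (h ^ α) ^ 2 := by
      rw [← Real.rpow_natCast (h ^ α), ← Real.rpow_mul hh.le, ← Real.rpow_add hh,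
        ← Real.rpow_natCast]
      congr 1
      push_cast
      ring
    rw [e]
    exact mul_le_mul_of_nonneg_right (Real.rpow_le_rpow hh.le hhD (by linarith [hα.2]))
      (sq_nonneg _)
  set Y := 8 * (c + 1) * (2 * C_u ^ 2 + 8 * D ^ (2 - 2 * α) * V) with hY
  have hW : √(8 * (c + 1) * (2 * E ^ 2 + 8 * h ^ 2 * V)) ≤ √Y * h ^ α := by
    have e : √Y * h ^ α = √(Y * (h ^ α) ^ 2) := by
      rw [Real.sqrt_mul' _ (sq_nonneg _), Real.sqrt_sq hha.le]
    rw [e]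
    refine Real.sqrt_le_sqrt ?_
    rw [hY, mul_assoc (8 * (c + 1)) (2 * C_u ^ 2 + 8 * D ^ (2 - 2 * α) * V)]
    refine mul_le_mul_of_nonneg_left ?_ (by positivity)
    have := mul_le_mul_of_nonneg_right hh2 hV0
    linarith
  have k1 : m * (B.length / (3 * M) / 2) ≤ 2 * (√N * (√Y * h ^ α)) :=
    (mul_le_mul_of_nonneg_left hS.le hm0).trans (hmain.trans (by gcongr))
  have k2 : m * B.length = 6 * M * (m * (B.length / (3 * M) / 2)) := by
    field_simp
    ring
  rw [k2]
  have := mul_le_mul_of_nonneg_left k1 (by positivity : 0 ≤ 6 * M)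
  linarith

/-! ### Bands of congruent isosceles triangles -/

theorem cross_sq_add_inner_sq (v w : Plane) :
    cross v w ^ 2 + inner ℝ v w ^ 2 = ‖v‖ ^ 2 * ‖w‖ ^ 2 := by
  rw [norm_sq_eq, norm_sq_eq, inner_eq, cross]; ring

theorem IsRegularIsosceles.area_K {b hbar : ℝ} (hb : 0 < b) (h : B.IsRegularIsosceles b hbar)
    (i : Fin (N + 1)) : area (B.K i) =
      area {0, EuclideanSpace.single 0 1, EuclideanSpace.single 1 1} * (b * hbar) := by
  obtain ⟨hpos, g, n, hg, hn, hgn, hP, hQ⟩ := h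
  have hc : |cross n g| = 1 := by
    have := cross_sq_add_inner_sq n g
    rw [hn, hg, real_inner_comm, hgn] at this
    rw [← sq_eq_sq₀ (abs_nonneg _) zero_le_one, sq_abs]
    linarith
  have e1 : B.Q i - B.P i.castSucc = (b / 2) • g + hbar • n := by rw [hQ]; abel
  have e2 : B.P i.succ - B.P i.castSucc = b • g := by
    rw [hP i.succ, hP i.castSucc, Fin.val_succ, Fin.val_castSucc]
    push_cast
    module
  have e3 : cross ((b / 2) • g + hbar • n) (b • g) = b * hbar * cross n g := by
    simp [cross]; ring
  rw [K, area_eq, e1, e2, e3, abs_mul, hc, mul_one, abs_of_pos (by positivity)]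

theorem IsRegularIsosceles.area_Ktilde {b hbar : ℝ} (hb : 0 < b)
    (h : B.IsRegularIsosceles b hbar) (i : Fin N) : area (B.Ktilde i) =
      area {0, EuclideanSpace.single 0 1, EuclideanSpace.single 1 1} * (b * hbar) := by
  obtain ⟨hpos, g, n, hg, hn, hgn, hP, hQ⟩ := h
  have hc : |cross n g| = 1 := by
    have := cross_sq_add_inner_sq n g
    rw [hn, hg, real_inner_comm, hgn] at this
    rw [← sq_eq_sq₀ (abs_nonneg _) zero_le_one, sq_abs]
    linarith
  have e1 : B.P i.succ.castSucc - B.Q i.castSucc = (b / 2) • g - hbar • n := by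
    rw [hQ, hP i.succ.castSucc, hP i.castSucc.castSucc]
    simp only [Fin.val_succ, Fin.val_castSucc]
    push_cast
    module
  have e2 : B.Q i.succ - B.Q i.castSucc = b • g := by
    rw [hQ, hQ, hP i.succ.castSucc, hP i.castSucc.castSucc]
    simp only [Fin.val_succ, Fin.val_castSucc]
    push_cast
    module
  have e3 : cross ((b / 2) • g - hbar • n) (b • g) = -(b * hbar) * cross n g := by
    simp [cross]; ring
  rw [Ktilde, area_eq, e1, e2, e3, abs_mul, hc, mul_one, abs_neg, abs_of_pos (by positivity)]

/-- The sine is exactly `b * hbar / (b² / 4 + hbar²)`; dropping `hbar²` gives the bound. -/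
theorem IsRegularIsosceles.sin_le {b hbar : ℝ} (hb : 0 < b)
    (h : B.IsRegularIsosceles b hbar) (i : Fin N) :
    0 < Real.sin (Real.pi - B.alphaTilde i) ∧
      Real.sin (Real.pi - B.alphaTilde i) ≤ 4 * hbar / b := by
  obtain ⟨hpos, g, n, hg, hn, hgn, hP, hQ⟩ := h
  rw [Real.sin_pi_sub, alphaTilde_eq]
  have e1 : B.Q i.castSucc - B.P i.succ.castSucc = -(b / 2) • g + hbar • n := by
    rw [hQ, hP i.succ.castSucc, hP i.castSucc.castSucc]
    simp only [Fin.val_succ, Fin.val_castSucc]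
    push_cast
    module
  have e2 : B.Q i.succ - B.P i.succ.castSucc = (b / 2) • g + hbar • n := by rw [hQ]; abel
  rw [e1, e2]
  have hng : inner ℝ n g = (0 : ℝ) := by rw [real_inner_comm, hgn]
  have hgg : inner ℝ g g = (1 : ℝ) := by rw [real_inner_self_eq_norm_sq, hg]; norm_num
  have hnn : inner ℝ n n = (1 : ℝ) := by rw [real_inner_self_eq_norm_sq, hn]; norm_num
  set r := -(b / 2) • g + hbar • n with hr
  set w := (b / 2) • g + hbar • n with hw
  have irr : inner ℝ r r = b ^ 2 / 4 + hbar ^ 2 := by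
    simp only [hr, inner_add_left, inner_add_right, real_inner_smul_left, real_inner_smul_right,
      hng, hgn, hgg, hnn]
    ring
  have iww : inner ℝ w w = b ^ 2 / 4 + hbar ^ 2 := by
    simp only [hw, inner_add_left, inner_add_right, real_inner_smul_left, real_inner_smul_right,
      hng, hgn, hgg, hnn]
    ring
  have irw : inner ℝ r w = -(b ^ 2 / 4) + hbar ^ 2 := by
    simp only [hr, hw, inner_add_left, inner_add_right, real_inner_smul_left,
      real_inner_smul_right, hng, hgn, hgg, hnn]
    ring
  have hs := InnerProductGeometry.sin_angle_mul_norm_mul_norm r w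
  have hnorm : ‖r‖ * ‖w‖ = b ^ 2 / 4 + hbar ^ 2 := by
    rw [norm_eq_sqrt_real_inner r, norm_eq_sqrt_real_inner w, irr, iww]
    exact Real.mul_self_sqrt (by positivity)
  rw [hnorm, irr, iww, irw, show (b ^ 2 / 4 + hbar ^ 2) * (b ^ 2 / 4 + hbar ^ 2) -
    (-(b ^ 2 / 4) + hbar ^ 2) * (-(b ^ 2 / 4) + hbar ^ 2) = (b * hbar) ^ 2 by ring,
    Real.sqrt_sq (by positivity)] at hs
  have hsin : Real.sin (InnerProductGeometry.angle r w) =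
      b * hbar / (b ^ 2 / 4 + hbar ^ 2) := by
    rw [eq_div_iff (by positivity)]; exact hs
  rw [hsin]
  refine ⟨by positivity, ?_⟩
  rw [div_le_div_iff₀ (by positivity) hb]
  nlinarith [pow_pos hpos 3]

theorem IsRegularIsosceles.length_eq {b hbar : ℝ} (hb : 0 < b)
    (h : B.IsRegularIsosceles b hbar) : B.length = (N + 1) * b := by
  obtain ⟨hpos, g, n, hg, hn, hgn, hP, hQ⟩ := h
  have hd : ∀ i : Fin (N + 1), dist (B.P i.castSucc) (B.P i.succ) = b := by
    intro i
    have e2 : B.P i.succ - B.P i.castSucc = b • g := by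
      rw [hP i.succ, hP i.castSucc, Fin.val_succ, Fin.val_castSucc]
      push_cast
      module
    rw [dist_comm, dist_eq_norm, e2, norm_smul, hg, mul_one, Real.norm_of_nonneg hb.le]
  rw [length, Finset.sum_congr rfl fun i _ => hd i]
  simp

/-- After squaring, the left side is of order `b³ * L² / hbar` and the right side of order `N *
b^(2α)`. Trading `N * b` for `L` cancels one power of `L`. -/
theorem IsRegularIsosceles.le_hbar (hN : 1 ≤ N) {b hbar α C κ : ℝ} (hb : 0 < b) (hC : 0 < C)
    (hκd : κ = area {0, EuclideanSpace.single 0 1, EuclideanSpace.single 1 1}) (hκ : 0 < κ)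
    (h : B.IsRegularIsosceles b hbar)
    (hest : (⨅ i : Fin N, 1 / Real.sin (Real.pi - B.alphaTilde i)) *
      (⨅ i : Fin N, √(area (B.Ktilde i))) * B.length ≤ √N * (C * b ^ α)) :
    κ / (16 * C ^ 2) * b ^ (4 - 2 * α) * B.length ≤ hbar := by
  have hpos : 0 < hbar := h.1
  have : Nonempty (Fin N) := ⟨⟨0, hN⟩⟩
  have m1 : b / (4 * hbar) ≤ ⨅ i : Fin N, 1 / Real.sin (Real.pi - B.alphaTilde i) := by
    refine le_ciInf fun i => ?_
    obtain ⟨s1, s2⟩ := h.sin_le hb i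
    rw [← one_div_div]
    exact one_div_le_one_div_of_le s1 s2
  have m2 : √(κ * (b * hbar)) ≤ ⨅ i : Fin N, √(area (B.Ktilde i)) := by
    refine le_ciInf fun i => ?_
    rw [h.area_Ktilde hb i, hκd]
  have hL := h.length_eq hb
  have hL0 : 0 < B.length := by rw [hL]; positivity
  have h1 : b / (4 * hbar) * √(κ * (b * hbar)) * B.length ≤ √N * (C * b ^ α) := by
    refine le_trans ?_ hest
    have : 0 ≤ ⨅ i : Fin N, 1 / Real.sin (Real.pi - B.alphaTilde i) :=
      le_trans (by positivity) m1
    gcongr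
  have h2 := pow_le_pow_left₀ (by positivity) h1 2
  rw [mul_pow, mul_pow, mul_pow, mul_pow, Real.sq_sqrt (by positivity),
    Real.sq_sqrt (by positivity), div_pow] at h2
  have hNL : (N : ℝ) * b ≤ B.length := by rw [hL]; nlinarith
  have hba : 0 < b ^ α := Real.rpow_pos_of_pos hb _
  have e4 : b ^ (4 - 2 * α) = b ^ 4 / (b ^ α) ^ 2 := by
    rw [Real.rpow_sub hb, mul_comm 2 α, Real.rpow_mul hb.le]
    norm_cast
  have h3 : b ^ 2 / (4 * hbar) ^ 2 * (κ * (b * hbar)) * B.length ^ 2 =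
      κ * b ^ 3 * B.length ^ 2 / (16 * hbar) := by
    field_simp
    ring
  rw [h3, div_le_iff₀ (by positivity)] at h2
  have h4 : κ * b ^ 4 * B.length * B.length ≤
      (C ^ 2 * (b ^ α) ^ 2 * (16 * hbar)) * B.length := by
    calc κ * b ^ 4 * B.length * B.length = κ * b ^ 3 * B.length ^ 2 * b := by ring
      _ ≤ N * (C ^ 2 * (b ^ α) ^ 2) * (16 * hbar) * b := by gcongr
      _ = (C ^ 2 * (b ^ α) ^ 2 * (16 * hbar)) * (N * b) := by ring
      _ ≤ _ := by gcongr
  have h5 := le_of_mul_le_mul_right h4 hL0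
  rw [e4, show κ / (16 * C ^ 2) * (b ^ 4 / (b ^ α) ^ 2) * B.length =
    κ * b ^ 4 * B.length / (16 * C ^ 2 * (b ^ α) ^ 2) by field_simp, div_le_iff₀ (by positivity)]
  linarith

end Band

end FEM

/-! ### Choice of the threshold and the constants -/

theorem corollary2p1 (Ω : Set FEM.Plane) (hΩ_open : IsOpen Ω) (hΩ_conn : IsConnected Ω)
    (hΩ_bdd : Bornology.IsBounded Ω) (hΩ_reg : interior (closure Ω) = Ω)
    (α : ℝ) (hα : α ∈ Set.Icc (0 : ℝ) 1) :
    -- the threshold `C_L` depends on `C(u)` (given `Ω`, `α`) and is small when `C(u)` is small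
    ∃ C_L : ℝ → ℝ, (∀ C_u > 0, 0 < C_L C_u) ∧
      Filter.Tendsto C_L (nhdsWithin 0 (Set.Ioi 0)) (nhds 0) ∧
      ∀ C_u > 0,
        (∀ C_K C_α : ℝ, ∃ C > 0, ∀ T : FEM.Triangulation Ω,
          (∃ U ∈ T.feSpace,
            FEM.h1Seminorm Ω (fun x => FEM.quadratic x - U x) ≤ C_u * T.meshSize ^ α) →
          ∀ N : ℕ, 1 ≤ N → ∀ B : FEM.Band T N,
            B.Comparable C_K C_α →
            C_L C_u * T.meshSize ^ (2 * α / 5) ≤ B.length →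
            (⨅ i : Fin N, 1 / Real.sin (Real.pi - B.alphaTilde i)) *
                (⨅ i : Fin N, √(FEM.area (B.Ktilde i))) * B.length * (N : ℝ) ^ (-(1 / 2) : ℝ)
              ≤ C * T.meshSize ^ α) ∧
        (∃ C > 0, ∀ T : FEM.Triangulation Ω,
          (∃ U ∈ T.feSpace,
            FEM.h1Seminorm Ω (fun x => FEM.quadratic x - U x) ≤ C_u * T.meshSize ^ α) →
          ∀ N : ℕ, 1 ≤ N → ∀ B : FEM.Band T N, ∀ hbar : ℝ,
            B.IsRegularIsosceles T.meshSize hbar →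
            C_L C_u * T.meshSize ^ (2 * α / 5) ≤ B.length →
            C * T.meshSize ^ (4 - 2 * α) * B.length ≤ hbar) := by
  by_cases hT : Nonempty (FEM.Triangulation Ω)
  swap
  -- Without any triangulation both claims are vacuous, so every admissible threshold works.
  · refine ⟨fun s => s, fun _ h => h, tendsto_id.mono_left nhdsWithin_le_nhds,
      fun C_u _ => ⟨fun _ _ => ⟨1, one_pos, fun T => absurd ⟨T⟩ hT⟩,
        1, one_pos, fun T => absurd ⟨T⟩ hT⟩⟩
  -- `T₀` is fixed before any mesh is given, so its number of elements and `ρ` depend on `Ω` alone.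
  obtain ⟨T₀⟩ := hT
  obtain ⟨ρ, hρ, hfar⟩ := T₀.exists_uniform_far
  obtain ⟨x₀, hx₀⟩ := hΩ_conn.nonempty
  obtain ⟨s₀, hs₀, -⟩ := T₀.exists_mem_of_mem_closure (subset_closure hx₀)
  have hM0 : 0 < T₀.elements.ncard := (Set.ncard_pos T₀.finite).2 ⟨s₀, hs₀⟩
  have hM : (0 : ℝ) < T₀.elements.ncard := by exact_mod_cast hM0
  set A : ℝ := 3 * T₀.elements.ncard * (48 * Metric.diam (closure Ω) ^ 2 * ρ⁻¹ + 1) with hA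
  have hA0 : 0 < A := by positivity
  have hκ : 0 < FEM.area {0, EuclideanSpace.single 0 1, EuclideanSpace.single 1 1} := by
    have h1 := T₀.area_pos hs₀
    obtain ⟨a, b, c, -, rfl⟩ := T₀.nondegenerate s₀ hs₀
    rw [FEM.area_eq] at h1
    exact pos_of_mul_pos_left h1 (abs_nonneg _)
  have hY : ∀ C_u > 0, ∀ c ≥ 0, 0 < 12 * (T₀.elements.ncard : ℝ) * √(8 * (c + 1) * (2 * C_u ^ 2 +
        8 * Metric.diam (closure Ω) ^ (2 - 2 * α) * (volume (closure Ω)).toReal)) := by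
    intro C_u hCu c hc
    have : 0 ≤ Metric.diam (closure Ω) ^ (2 - 2 * α) := Real.rpow_nonneg Metric.diam_nonneg _
    positivity
  refine ⟨fun s => A * s ^ (2 / 5 : ℝ), fun C_u hCu => by positivity, ?_, fun C_u hCu => ⟨?_, ?_⟩⟩
  · have hc : ContinuousAt (fun s : ℝ => A * s ^ (2 / 5 : ℝ)) 0 :=
      (Real.continuousAt_rpow_const 0 (2 / 5) (Or.inr (by norm_num))).const_mul A
    have := hc.tendsto.mono_left (nhdsWithin_le_nhds (s := Set.Ioi 0))
    simpa using this
  · intro C_K C_α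
    -- The band estimate needs a nonnegative comparison constant, hence `|C_K|`.
    refine ⟨_, hY C_u hCu |C_K| (abs_nonneg _), fun T ⟨U, hU, herr⟩ N hN B hB hlen => ?_⟩
    have key := FEM.Band.iInf_mul_length_le hΩ_bdd hΩ_reg hα hU hCu herr T₀ hM0 hρ hfar hlen
      (abs_nonneg C_K) (fun i => ⟨(hB i).1.trans (mul_le_mul_of_nonneg_right (le_abs_self _)
        ENNReal.toReal_nonneg), (hB i).2.1.trans (mul_le_mul_of_nonneg_right (le_abs_self _)
        ENNReal.toReal_nonneg)⟩)
    have hN' : (0 : ℝ) < N := by exact_mod_cast hN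
    rw [Real.rpow_neg hN'.le, ← Real.sqrt_eq_rpow, ← div_eq_mul_inv,
      div_le_iff₀ (Real.sqrt_pos.2 hN')]
    linarith
  -- All triangles of a regular band have the same area, so the comparison constant is `1`.
  · have hC := hY C_u hCu 1 zero_le_one
    refine ⟨_, div_pos hκ (by positivity : 0 < 16 * (12 * (T₀.elements.ncard : ℝ) *
      √(8 * (1 + 1) * (2 * C_u ^ 2 + 8 * Metric.diam (closure Ω) ^ (2 - 2 * α) *
        (volume (closure Ω)).toReal))) ^ 2), fun T ⟨U, hU, herr⟩ N hN B hbar hB hlen => ?_⟩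
    have hb := T.meshSize_pos (B.mem_K 0)
    exact hB.le_hbar hN hb hC rfl hκ (FEM.Band.iInf_mul_length_le hΩ_bdd hΩ_reg hα hU hCu herr T₀
      hM0 hρ hfar hlen zero_le_one (fun i => by
        rw [hB.area_Ktilde hb, hB.area_K hb, hB.area_K hb, one_mul]; exact ⟨le_rfl, le_rfl⟩))
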